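/- Let $p,q\ge 1$, $p+q=n+1$, and let $M\subset\mathbb R^n$ be a compact domain with Lipschitz boundary (standard orientation) carrying a continuous Riemannian metric $g$; write $(a,b)_M=\int_M\langle a,b\rangle_g\,\mathrm{vol}_g$ for the $L^2$ inner product of forms. Let $\Gamma_1,\Gamma_2\subset\partial M$ be disjoint and relatively open with $\overline{\Gamma}_1\cup\overline{\Gamma}_2=\partial M$, and let $\partial M\setminus(\Gamma_1\cup\Gamma_2)$ have surface measure zero. For forms of complementary degrees write $(a\,|\,b)_M=\int_M a\wedge b$ and $\langle a\,|\,b\rangle_{\Gamma_i}=\int_{\Gamma_i}a\wedge b$ (boundary orientation), and let $\operatorname{tr}$ be the pullback to the boundary. Let $\mathcal T_h$ be a decomposition of $M$ into finitely many compact Lipschitz cells $T$ with pairwise disjoint interiors. For each cell let $W_h^k(T)$ be finite-dimensional spaces of $k$-forms of class $C^1$ up to the boundary of $T$, with $\mathrm d W_h^k(T)\subset W_h^{k+1}(T)$, and put $W_h^k=\prod_T W_h^k(T)$. Let $V_h^k\subset H\Omega^k(M)=\{\omega\in L^2:\mathrm d\omega\in L^2\}$ be linear spaces with $\mathrm dV_h^k\subset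 V_h^{k+1}$ whose elements restrict to elements of $W_h^k(T)$ on every cell. Let $\hat W_h^k(T),\hat W_h^k,\hat V_h^k$ be a second family of the same kind (for outer oriented forms). Let $V_h^k(\Gamma_1)$ and $\hat V_h^k(\Gamma_2)$ be the subspaces of $V_h^k$ and $\hat V_h^k$ with vanishing trace on $\Gamma_1$ and $\Gamma_2$ respectively. Let $u_1(t)\in \operatorname{tr}V_h^{q-1}|_{\Gamma_1}$ and $\hat u_2(t)\in \operatorname{tr}\hat V_h^{p-1}|_{\Gamma_2}$, $t\in(0,T_{\rm end}]$, be inputs, and let the trajectories below be differentiable in time and satisfy the following for all $t\in(0,T_{\rm end}]$. Primal system: $\hat\alpha_h\in\hat W_h^p$, $\hat\beta_h\in\hat V_h^{p-1}$, $(-1)^p\operatorname{tr}\hat\beta_h|_{\Gamma_2}=\hat u_2$, and $$(\hat v,\partial_t\hat\alpha_h)_M=(-1)^p(\hat v,\mathrm d\hat\beta_h)_M\quad\forall \hat v\in\hat W_h^p,$$ $$(\hat v,\partial_t\hat\beta_h)_M=(-1)^p\{-(\mathrm d\hat v,\hat\alpha_h)_M+\langle\operatorname{tr}\hat v\,|\,u_1\rangle_{\Gamma_1}\}\quad\forall\hat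 v\in\hat V_h^{p-1}(\Gamma_2).$$ Dual system: $\alpha_h\in V_h^{q-1}$, $\beta_h\in W_h^q$, $\operatorname{tr}\alpha_h|_{\Gamma_1}=u_1$, and $$(v,\partial_t\alpha_h)_M=(\mathrm dv,\beta_h)_M+(-1)^{(p-1)(q-1)}\langle\operatorname{tr}v\,|\,\hat u_2\rangle_{\Gamma_2}\quad\forall v\in V_h^{q-1}(\Gamma_1),$$ $$(v,\partial_t\beta_h)_M=-(v,\mathrm d\alpha_h)_M\quad\forall v\in W_h^q.$$ Then, with the outputs $y_1=\operatorname{tr}\alpha_h|_{\Gamma_2}$ and $\hat y_2=(-1)^p\operatorname{tr}\hat\beta_h|_{\Gamma_1}$, the discrete power balance $$(-1)^{p(n-p)}(\alpha_h\,|\,\partial_t\hat\alpha_h)_M+(\hat\beta_h\,|\,\partial_t\beta_h)_M=\langle\hat y_2\,|\,u_1\rangle_{\Gamma_1}+\langle\hat u_2\,|\,y_1\rangle_{\Gamma_2}$$ holds for every $t\in(0,T_{\rm end}]$. -/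

import Mathlib

open MeasureTheory Set Filter Topology

namespace PortHam

noncomputable section

/-! ### Pointwise exterior algebra -/

/-- Ambient space of dimension `m + 1`. -/
abbrev Space (m : ℕ) : Type := EuclideanSpace ℝ (Fin (m + 1))

/-- Exterior `k`-covectors on a normed space. -/
abbrev Alt (X : Type) [NormedAddCommGroup X] [NormedSpace ℝ X] (k : ℕ) : Type :=
  X [⋀^Fin k]→L[ℝ] ℝ

/-- Fields of `k`-covectors on the ambient space. -/
abbrev FormField (m k : ℕ) : Type := Space m → Alt (Space m) k

/-- The `i`-th vector of the standard basis of the ambient space. -/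
def stdVec (m : ℕ) (i : Fin (m + 1)) : Space m := EuclideanSpace.single i 1

/-- `(a ∧ b)(v₀, …, v_{N-1})`, where `N = k + l`:
`1 / (k! l!) ∑_σ sgn σ a(v_σ(0), …, v_σ(k-1)) b(v_σ(k), …, v_σ(N-1))`. -/
def wedgeEval {X : Type} [NormedAddCommGroup X] [NormedSpace ℝ X] {k l N : ℕ} (h : k + l = N)
    (a : Alt X k) (b : Alt X l) (v : Fin N → X) : ℝ :=
  ((k.factorial : ℝ) * (l.factorial : ℝ))⁻¹ *
    ∑ σ : Equiv.Perm (Fin N), ((Equiv.Perm.sign σ : ℤ) : ℝ) *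
      a (fun i => v (σ (Fin.cast h (Fin.castAdd l i)))) *
      b (fun j => v (σ (Fin.cast h (Fin.natAdd k j))))

/-- Inner product of two `k`-covectors induced by the metric tensor `G = (g_ij)`:
`1 / k! ∑ g^{i₁j₁} ⋯ g^{i_kj_k} a_{i₁…i_k} b_{j₁…j_k}`, summed over all multi-indices. -/
def covInner {m k : ℕ} (G : Matrix (Fin (m + 1)) (Fin (m + 1)) ℝ)
    (a b : Alt (Space m) k) : ℝ :=
  (k.factorial : ℝ)⁻¹ * ∑ I : Fin k → Fin (m + 1), ∑ J : Fin k → Fin (m + 1),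
    (∏ l, G⁻¹ (I l) (J l)) * a (fun l => stdVec m (I l)) * b (fun l => stdVec m (J l))

/-- A (continuous) Riemannian metric on `M`, given by its matrix in the standard coordinates. -/
structure IsRiemannianMetric {m : ℕ} (M : Set (Space m))
    (g : Space m → Matrix (Fin (m + 1)) (Fin (m + 1)) ℝ) : Prop where
  cont : ContinuousOn g M
  posDef : ∀ x ∈ M, (g x).PosDef

/-! ### Sobolev spaces of forms -/

/-- `η` is the exterior derivative of `ω` on the open set `U` in the sense of distributions:
`∫_U η ∧ φ = (-1)^(k+1) ∫_U ω ∧ dφ` for all smooth `φ` with compact support in `U`. -/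
def IsWeakExtDeriv {m k : ℕ} (U : Set (Space m)) (ω : FormField m k) (η : FormField m (k + 1)) :
    Prop :=
  ∀ (l : ℕ) (h : k + 1 + l = m + 1) (φ : FormField m l),
    ContDiff ℝ (⊤ : ℕ∞) φ → HasCompactSupport φ → tsupport φ ⊆ U →
      ∫ x in U, wedgeEval h (η x) (φ x) (stdVec m) =
        (-1) ^ (k + 1) *
          ∫ x in U, wedgeEval (by omega : k + (l + 1) = m + 1) (ω x) (extDeriv φ x) (stdVec m)

/-- Membership in `HΩᵏ(U)`: square integrable forms with square integrable weak exterior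
derivative. -/
def MemHForm {m k : ℕ} (U : Set (Space m)) (ω : FormField m k) : Prop :=
  MemLp ω 2 (volume.restrict U) ∧
    ∃ η : FormField m (k + 1), MemLp η 2 (volume.restrict U) ∧ IsWeakExtDeriv U ω η

/-! ### Lipschitz domains -/

/-- A local description of `T` as one side of the graph of a Lipschitz function: on the open set
`U`, in the orthonormal coordinates `y = frame x`, the set `T` is
`{y₀ ≤ height (y₁, …, y_m)}`. -/
structure LipschitzChart {m : ℕ} (T : Set (Space m)) where
  U : Set (Space m)
  isOpen_U : IsOpen U
  frame : Space m ≃ₗᵢ[ℝ] Space m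
  height : (Fin m → ℝ) → ℝ
  lipschitz : ∃ K, LipschitzWith K height
  mem_iff : ∀ x ∈ U, x ∈ T ↔ frame x 0 ≤ height (fun i => frame x i.succ)

/-- The parametrization `(y₁, …, y_m) ↦ (height y, y₁, …, y_m)` of the boundary. -/
def LipschitzChart.param {m : ℕ} {T : Set (Space m)} (c : LipschitzChart T) (y : Fin m → ℝ) :
    Space m :=
  c.frame.symm (WithLp.toLp 2 (Fin.cons (c.height y) y))

/-- The sign of the parametrization with respect to the boundary orientation of `T` (outward normal
first); the outward direction is the one of growing `y₀`, so it is the orientation of the frame. -/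
def LipschitzChart.orient {m : ℕ} {T : Set (Space m)} (c : LipschitzChart T) : ℝ :=
  LinearMap.det (c.frame.toLinearEquiv : Space m →ₗ[ℝ] Space m)

/-- Finitely many Lipschitz charts around the boundary of `T`, with a subordinate smooth partition
of unity near the boundary. -/
structure LipschitzAtlas {m : ℕ} (T : Set (Space m)) where
  N : ℕ
  chart : Fin N → LipschitzChart T
  cutoff : Fin N → Space m → ℝ
  smooth : ∀ j, ContDiff ℝ (⊤ : ℕ∞) (cutoff j)
  compact_supp : ∀ j, HasCompactSupport (cutoff j)
  supp_subset : ∀ j, tsupport (cutoff j) ⊆ (chart j).U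
  sum_eq_one : ∀ᶠ x in 𝓝ˢ (frontier T), ∑ j, cutoff j x = 1

/-- `M` is a closed bounded domain with Lipschitz boundary. -/
def IsLipschitzDomain {m : ℕ} (M : Set (Space m)) : Prop :=
  IsCompact M ∧ Nonempty (LipschitzAtlas M)

/-- A partition of `∂M` into two relatively open parts, up to an interface which is negligible for
the surface measure. -/
structure IsBoundaryPartition {m : ℕ} (M Γ₁ Γ₂ : Set (Space m)) : Prop where
  open₁ : ∃ O, IsOpen O ∧ Γ₁ = O ∩ frontier M
  open₂ : ∃ O, IsOpen O ∧ Γ₂ = O ∩ frontier M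
  disjoint : Disjoint Γ₁ Γ₂
  closure_union : closure Γ₁ ∪ closure Γ₂ = frontier M
  interface_null : Measure.hausdorffMeasure (m : ℝ) (frontier M \ (Γ₁ ∪ Γ₂)) = 0

/-! ### Meshes and broken forms -/

/-- A decomposition of `M` into finitely many closed bounded Lipschitz cells. -/
structure Mesh {m : ℕ} (M : Set (Space m)) (ι : Type) [Fintype ι] where
  cell : ι → Set (Space m)
  isCompact_cell : ∀ i, IsCompact (cell i)
  atlas : ∀ i, LipschitzAtlas (cell i)
  disjoint_interior : Pairwise fun i j => Disjoint (interior (cell i)) (interior (cell j))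
  iUnion_cell : ⋃ i, cell i = M

/-- Forms on the cell `T` of class `C¹` up to the boundary, extended by zero outside `T`. -/
def cellForms {m : ℕ} (T : Set (Space m)) (k : ℕ) : Submodule ℝ (FormField m k) where
  carrier := {ω | (∀ x, x ∉ T → ω x = 0) ∧
    ∃ ω' : FormField m k, ContDiff ℝ 1 ω' ∧ EqOn ω ω' T}
  zero_mem' := ⟨fun _ _ => rfl, 0, contDiff_const, fun _ _ => rfl⟩
  add_mem' := by
    rintro a b ⟨ha, a', ha', hab⟩ ⟨hb, b', hb', hbb⟩
    refine ⟨fun x hx => ?_, a' + b', ha'.add hb', fun x hx => ?_⟩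
    · simp [ha x hx, hb x hx]
    · simp [hab hx, hbb hx]
  smul_mem' := by
    rintro c a ⟨ha, a', ha', hab⟩
    refine ⟨fun x hx => ?_, c • a', contDiff_const.smul ha', fun x hx => ?_⟩
    · simp [ha x hx]
    · simp [hab hx]

/-- Exterior derivative of a form on the cell `T`. -/
def cellD {m k : ℕ} (T : Set (Space m)) (ω : FormField m k) : FormField m (k + 1) :=
  T.indicator (extDerivWithin ω T)

variable {m : ℕ} {M : Set (Space m)} {ι : Type} [Fintype ι]

/-- Broken forms: one form on each cell. -/
abbrev BrokenForm (m : ℕ) (ι : Type) (k : ℕ) : Type := ι → FormField m k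

namespace Mesh

/-- The form on `M` defined almost everywhere by a broken form. -/
def glue (𝓣 : Mesh M ι) {k : ℕ} (a : BrokenForm m ι k) : FormField m k :=
  fun x => ∑ i, (interior (𝓣.cell i)).indicator (a i) x

/-- Elementwise exterior derivative. -/
def d (𝓣 : Mesh M ι) {k : ℕ} (a : BrokenForm m ι k) : BrokenForm m ι (k + 1) :=
  fun i => cellD (𝓣.cell i) (a i)

/-- The `L²` inner product `∫_M ⟨a, b⟩_g vol_g`. -/
def inner (𝓣 : Mesh M ι) (g : Space m → Matrix (Fin (m + 1)) (Fin (m + 1)) ℝ) {k : ℕ}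
    (a b : BrokenForm m ι k) : ℝ :=
  ∑ i, ∫ x in 𝓣.cell i, covInner (g x) (a i x) (b i x) * √(g x).det

/-- The duality product `∫_M a ∧ b` of forms of complementary degrees. -/
def dual (𝓣 : Mesh M ι) {k l : ℕ} (h : k + l = m + 1)
    (a : BrokenForm m ι k) (b : BrokenForm m ι l) : ℝ :=
  ∑ i, ∫ x in 𝓣.cell i, wedgeEval h (a i x) (b i x) (stdVec m)

/-! ### Traces -/

/-- Forms on the disjoint union of the cell boundaries, in the charts of the cells. -/
abbrev BdForm (𝓣 : Mesh M ι) (k : ℕ) : Type :=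
  (i : ι) → Fin (𝓣.atlas i).N → (Fin m → ℝ) → Alt (Fin m → ℝ) k

/-- The trace: on each cell, the pullback to the boundary of the cell. -/
def tr (𝓣 : Mesh M ι) {k : ℕ} (a : BrokenForm m ι k) : 𝓣.BdForm k := fun i j y =>
  (a i (((𝓣.atlas i).chart j).param y)).compContinuousLinearMap
    (fderiv ℝ ((𝓣.atlas i).chart j).param y)

/-- Two boundary forms agree (almost everywhere) on the part `Γ` of the boundary. -/
def EqOnBd (𝓣 : Mesh M ι) {k : ℕ} (Γ : Set (Space m)) (a b : 𝓣.BdForm k) : Prop :=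
  ∀ i j, ∀ᵐ y : Fin m → ℝ, ((𝓣.atlas i).chart j).param y ∈ Γ ∩ ((𝓣.atlas i).chart j).U →
    a i j y = b i j y

/-- The boundary duality product `∫_Γ a ∧ b` for `Γ ⊆ ∂M`, in the boundary orientation. -/
def bdDual (𝓣 : Mesh M ι) {k l : ℕ} (h : k + l = m) (Γ : Set (Space m))
    (a : 𝓣.BdForm k) (b : 𝓣.BdForm l) : ℝ :=
  ∑ i, ∑ j, ((𝓣.atlas i).chart j).orient *
    ∫ y in ((𝓣.atlas i).chart j).param ⁻¹' Γ,
      (𝓣.atlas i).cutoff j (((𝓣.atlas i).chart j).param y) *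
        wedgeEval h (a i j y) (b i j y) (fun e => Pi.single e 1)

end Mesh

/-! ### Discrete spaces -/

/-- Finite element spaces of differential forms on a mesh: on every cell a finite dimensional
subcomplex `W_hᵏ(T)`, and a subcomplex `V_hᵏ` of `HΩᵏ(M)` whose members restrict to elements of
`W_hᵏ(T)` on every cell. -/
structure DiscreteComplex (𝓣 : Mesh M ι) where
  W : ι → (k : ℕ) → Submodule ℝ (FormField m k)
  W_le : ∀ i k, W i k ≤ cellForms (𝓣.cell i) k
  W_finite : ∀ i k, FiniteDimensional ℝ (W i k)
  W_d : ∀ i k, ∀ ω ∈ W i k, cellD (𝓣.cell i) ω ∈ W i (k + 1)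
  V : (k : ℕ) → Submodule ℝ (BrokenForm m ι k)
  V_restrict : ∀ k, ∀ ω ∈ V k, ∀ i, ω i ∈ W i k
  V_conforming : ∀ k, ∀ ω ∈ V k, MemHForm (interior M) (𝓣.glue ω)
  V_d : ∀ k, ∀ ω ∈ V k, 𝓣.d ω ∈ V (k + 1)

namespace DiscreteComplex

variable {𝓣 : Mesh M ι}

/-- The broken space `W_hᵏ = ∏_T W_hᵏ(T)`. -/
def broken (C : DiscreteComplex 𝓣) (k : ℕ) : Set (BrokenForm m ι k) :=
  {ω | ∀ i, ω i ∈ C.W i k}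

/-- `V_hᵏ(Γ)`: conforming discrete forms with vanishing trace on `Γ`. -/
def conformingZero (C : DiscreteComplex 𝓣) (Γ : Set (Space m)) (k : ℕ) :
    Set (BrokenForm m ι k) :=
  {ω | ω ∈ C.V k ∧ 𝓣.EqOnBd Γ (𝓣.tr ω) 0}

/-- The control space `tr V_hᵏ|_Γ`. -/
def control (C : DiscreteComplex 𝓣) (Γ : Set (Space m)) (k : ℕ) : Set (𝓣.BdForm k) :=
  {u | ∃ ω ∈ C.V k, 𝓣.EqOnBd Γ (𝓣.tr ω) u}

end DiscreteComplex

/-! ### Discrete systems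

In the following `p = r + 1`, `q = s + 1` and `n = m + 1 = r + s + 1`, so `p + q = n + 1`. -/

/-- The trajectory `a` is differentiable in time on `I`. For trajectories in a finite dimensional
space of forms this is differentiability in that space. -/
def TimeDiff {k : ℕ} (I : Set ℝ) (a : ℝ → BrokenForm m ι k) : Prop :=
  ∀ i x, DifferentiableOn ℝ (fun τ => a τ i x) I

/-- The time derivative of a trajectory. -/
def dt {k : ℕ} (I : Set ℝ) (a : ℝ → BrokenForm m ι k) (t : ℝ) : BrokenForm m ι k :=
  fun i x => derivWithin (fun τ => a τ i x) I t

/-- The discrete primal system, for the outer oriented spaces `Co` (the inner oriented spaces `Ci`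
enter only through the control space of `u₁`). -/
structure IsPrimalSolution {r s : ℕ} (𝓣 : Mesh M ι)
    (g : Space m → Matrix (Fin (m + 1)) (Fin (m + 1)) ℝ) (h : r + s = m)
    (Γ₁ Γ₂ : Set (Space m)) (Co Ci : DiscreteComplex 𝓣) (I : Set ℝ)
    (u₁ : ℝ → 𝓣.BdForm s) (u₂ : ℝ → 𝓣.BdForm r)
    (αo : ℝ → BrokenForm m ι (r + 1)) (βo : ℝ → BrokenForm m ι r) : Prop where
  α_mem : ∀ t ∈ I, αo t ∈ Co.broken (r + 1)
  β_mem : ∀ t ∈ I, βo t ∈ Co.V r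
  α_diff : TimeDiff I αo
  β_diff : TimeDiff I βo
  u₁_mem : ∀ t ∈ I, u₁ t ∈ Ci.control Γ₁ s
  u₂_mem : ∀ t ∈ I, u₂ t ∈ Co.control Γ₂ r
  essential : ∀ t ∈ I, 𝓣.EqOnBd Γ₂ ((-1 : ℝ) ^ (r + 1) • 𝓣.tr (βo t)) (u₂ t)
  eq₁ : ∀ t ∈ I, ∀ v ∈ Co.broken (r + 1),
    𝓣.inner g v (dt I αo t) = (-1) ^ (r + 1) * 𝓣.inner g v (𝓣.d (βo t))
  eq₂ : ∀ t ∈ I, ∀ v ∈ Co.conformingZero Γ₂ r,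
    𝓣.inner g v (dt I βo t) =
      (-1) ^ (r + 1) * (-𝓣.inner g (𝓣.d v) (αo t) + 𝓣.bdDual h Γ₁ (𝓣.tr v) (u₁ t))

/-- The discrete dual system, for the inner oriented spaces `Ci` (the outer oriented spaces `Co`
enter only through the control space of `u₂`). -/
structure IsDualSolution {r s : ℕ} (𝓣 : Mesh M ι)
    (g : Space m → Matrix (Fin (m + 1)) (Fin (m + 1)) ℝ) (h : r + s = m)
    (Γ₁ Γ₂ : Set (Space m)) (Co Ci : DiscreteComplex 𝓣) (I : Set ℝ)
    (u₁ : ℝ → 𝓣.BdForm s) (u₂ : ℝ → 𝓣.BdForm r)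
    (αi : ℝ → BrokenForm m ι s) (βi : ℝ → BrokenForm m ι (s + 1)) : Prop where
  α_mem : ∀ t ∈ I, αi t ∈ Ci.V s
  β_mem : ∀ t ∈ I, βi t ∈ Ci.broken (s + 1)
  α_diff : TimeDiff I αi
  β_diff : TimeDiff I βi
  u₁_mem : ∀ t ∈ I, u₁ t ∈ Ci.control Γ₁ s
  u₂_mem : ∀ t ∈ I, u₂ t ∈ Co.control Γ₂ r
  essential : ∀ t ∈ I, 𝓣.EqOnBd Γ₁ (𝓣.tr (αi t)) (u₁ t)
  eq₁ : ∀ t ∈ I, ∀ v ∈ Ci.conformingZero Γ₁ s,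
    𝓣.inner g v (dt I αi t) = 𝓣.inner g (𝓣.d v) (βi t) +
      (-1) ^ (r * s) * 𝓣.bdDual (by omega : s + r = m) Γ₂ (𝓣.tr v) (u₂ t)
  eq₂ : ∀ t ∈ I, ∀ v ∈ Ci.broken (s + 1),
    𝓣.inner g v (dt I βi t) = -𝓣.inner g v (𝓣.d (αi t))

/-- The output `y₁ = tr α` (used on `Γ₂`). -/
def output₁ {s : ℕ} (𝓣 : Mesh M ι) (αi : ℝ → BrokenForm m ι s) (t : ℝ) : 𝓣.BdForm s :=
  𝓣.tr (αi t)

/-- The output `y₂ = (-1)^p tr β`, `p = r + 1` (used on `Γ₁`). -/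
def output₂ {r : ℕ} (𝓣 : Mesh M ι) (βo : ℝ → BrokenForm m ι r) (t : ℝ) : 𝓣.BdForm r :=
  (-1 : ℝ) ^ (r + 1) • 𝓣.tr (βo t)

end

end PortHam

/-! The equations tested with broken forms hold pointwise almost everywhere. Both
$\partial_t\hat\alpha_h$ and $\mathrm d\hat\beta_h$ lie in the broken space, so the residual may
serve as its own test form and definiteness of the metric kills it
(`DiscreteComplex.ae_eq_smul_of_inner`). Hence $\partial_t\hat\alpha_h=(-1)^p\mathrm d\hat\beta_h$
and $\partial_t\beta_h=-\mathrm d\alpha_h$, and the metric disappears. By the Leibniz rule the left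
side of the balance becomes $(-1)^p\sum_T\int_T\mathrm d(\hat\beta_h\wedge\alpha_h)$
(`Mesh.IsExtension.dual_add_dual`). Stokes' theorem leaves integrals over $\Gamma_1$ and $\Gamma_2$,
and the essential boundary conditions $\operatorname{tr}\alpha_h=u_1$ and
$(-1)^p\operatorname{tr}\hat\beta_h=\hat u_2$ turn them into the supplied power.

The work lies in Stokes' theorem for two conforming forms that are only piecewise $C^1$. On one cell
it is `LipschitzAtlas.integral_extDeriv`: a partition of unity reduces it to the subgraph of a
Lipschitz function, where a shear, Fubini and Rademacher's theorem give the divergence theorem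
(`integral_fderiv_subgraph`).

After summation over the cells the interior interfaces must cancel. The cells need not match face to
face, so the cancellation is taken from the weak derivative instead of from traces on common faces.
For a cutoff $\chi$ supported in the interior of $M$, $\sum_T\int_T\mathrm d(a\wedge\chi b)=0$: if
$b$ is mollified, $\chi b$ is a legitimate test form for $a$; since $b$ is conforming too,
mollification commutes with its piecewise derivative; dominated convergence removes the mollifier
(`Mesh.IsExtension.sum_integral_extDeriv_cutoff`). Cellwise Stokes converts this into a statement on
boundary integrals weighted by $\chi$, and $\chi$ tends pointwise to the indicator of the interior
(`Mesh.IsExtension.sum_bdIntegral_interior`). The remaining interface between $\Gamma_1$ and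
$\Gamma_2$ is negligible in every chart (`LipschitzChart.ae_param_notMem`). -/

open MeasureTheory Set Filter Topology

namespace PortHam

noncomputable section

/-! ### The wedge product -/

section Wedge

variable {X Y : Type} [NormedAddCommGroup X] [NormedSpace ℝ X] [NormedAddCommGroup Y]
  [NormedSpace ℝ Y] {k l N : ℕ}

/-- The multilinear map `v ↦ a(v₀, …, v_{k-1}) b(v_k, …, v_{N-1})`. -/
def tensorMul (h : k + l = N) (a : Alt X k) (b : Alt X l) :
    MultilinearMap ℝ (fun _ : Fin N => X) ℝ :=
  (LinearMap.mul' ℝ ℝ).compMultilinearMap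
    ((a.toMultilinearMap.domCoprod b.toMultilinearMap).domDomCongr
      (finSumFinEquiv.trans (finCongr h)))

lemma tensorMul_apply (h : k + l = N) (a : Alt X k) (b : Alt X l) (v : Fin N → X) :
    tensorMul h a b v = a (fun i => v (Fin.cast h (Fin.castAdd l i))) *
      b (fun j => v (Fin.cast h (Fin.natAdd k j))) := by
  simp [tensorMul]

/-- This form makes the alternating property in `v` automatic, so that `wedge₀` needs only a norm
bound. -/
lemma wedgeEval_eq_alternatization (h : k + l = N) (a : Alt X k) (b : Alt X l) (v : Fin N → X) :
    wedgeEval h a b v = (((k.factorial : ℝ) * (l.factorial : ℝ))⁻¹ •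
      MultilinearMap.alternatization (tensorMul h a b)) v := by
  simp only [wedgeEval, AlternatingMap.smul_apply, MultilinearMap.alternatization_apply,
    MultilinearMap.domDomCongr_apply, tensorMul_apply, smul_eq_mul]
  congr 1
  refine Finset.sum_congr rfl fun σ _ => ?_
  rw [Units.smul_def, zsmul_eq_mul, mul_assoc]

/-- Each summand is bounded by the product of the norms, and the normalising factor is at most 1.
The crude constant suffices: only continuity of the bilinear map is wanted, for the product rule in
`extDeriv_wedge`. -/
lemma abs_wedgeEval_le (h : k + l = N) (a : Alt X k) (b : Alt X l) (v : Fin N → X) :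
    |wedgeEval h a b v| ≤ N.factorial * ‖a‖ * ‖b‖ * ∏ i, ‖v i‖ := by
  subst h
  have key : ∀ σ : Equiv.Perm (Fin (k + l)),
      |((Equiv.Perm.sign σ : ℤ) : ℝ) * a (fun i => v (σ (Fin.cast rfl (Fin.castAdd l i)))) *
        b (fun j => v (σ (Fin.cast rfl (Fin.natAdd k j))))| ≤ ‖a‖ * ‖b‖ * ∏ i, ‖v i‖ := by
    intro σ
    have hs : |((Equiv.Perm.sign σ : ℤ) : ℝ)| = 1 := by
      rcases Int.units_eq_one_or (Equiv.Perm.sign σ) with h | h <;> simp [h]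
    rw [abs_mul, abs_mul, hs, one_mul]
    calc _ ≤ (‖a‖ * ∏ i, ‖v (σ (Fin.castAdd l i))‖) * (‖b‖ * ∏ j, ‖v (σ (Fin.natAdd k j))‖) := by
            gcongr
            · exact a.le_opNorm _
            · exact b.le_opNorm _
      _ = ‖a‖ * ‖b‖ * ∏ i, ‖v (σ i)‖ := by rw [Fin.prod_univ_add]; ring
      _ = _ := by rw [Equiv.prod_comp σ (fun i => ‖v i‖)]
  have h1 : ((k.factorial : ℝ) * (l.factorial : ℝ))⁻¹ ≤ 1 := by
    apply inv_le_one_of_one_le₀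
    exact_mod_cast Nat.mul_pos k.factorial_pos l.factorial_pos
  have h2 := (Finset.abs_sum_le_sum_abs _ _).trans (Finset.sum_le_sum fun σ
    (_ : σ ∈ (Finset.univ : Finset (Equiv.Perm (Fin (k + l))))) => key σ)
  rw [wedgeEval, abs_mul, abs_of_nonneg (by positivity)]
  refine (mul_le_mul h1 h2 (abs_nonneg _) zero_le_one).trans ?_
  simp [Fintype.card_perm, mul_assoc]

/-- The wedge product as a continuous alternating map. -/
def wedge₀ (h : k + l = N) (a : Alt X k) (b : Alt X l) : Alt X N :=
  AlternatingMap.mkContinuous (((k.factorial : ℝ) * (l.factorial : ℝ))⁻¹ •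
      MultilinearMap.alternatization (tensorMul h a b)) (N.factorial * ‖a‖ * ‖b‖) fun v => by
    rw [← wedgeEval_eq_alternatization]
    exact abs_wedgeEval_le h a b v

lemma wedge₀_apply (h : k + l = N) (a : Alt X k) (b : Alt X l) (v : Fin N → X) :
    wedge₀ h a b v = wedgeEval h a b v := by
  rw [wedgeEval_eq_alternatization]
  rfl

lemma norm_wedge₀_le (h : k + l = N) (a : Alt X k) (b : Alt X l) :
    ‖wedge₀ h a b‖ ≤ N.factorial * ‖a‖ * ‖b‖ :=
  AlternatingMap.mkContinuous_norm_le _ (by positivity) _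

lemma wedgeEval_add_left (h : k + l = N) (a a' : Alt X k) (b : Alt X l) (v : Fin N → X) :
    wedgeEval h (a + a') b v = wedgeEval h a b v + wedgeEval h a' b v := by
  simp only [wedgeEval, ContinuousAlternatingMap.add_apply, mul_add, add_mul,
    Finset.sum_add_distrib]

lemma wedgeEval_smul_left (h : k + l = N) (c : ℝ) (a : Alt X k) (b : Alt X l) (v : Fin N → X) :
    wedgeEval h (c • a) b v = c * wedgeEval h a b v := by
  simp only [wedgeEval, ContinuousAlternatingMap.smul_apply, Finset.mul_sum, smul_eq_mul]
  exact Finset.sum_congr rfl fun _ _ => by ring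

lemma wedgeEval_add_right (h : k + l = N) (a : Alt X k) (b b' : Alt X l) (v : Fin N → X) :
    wedgeEval h a (b + b') v = wedgeEval h a b v + wedgeEval h a b' v := by
  simp only [wedgeEval, ContinuousAlternatingMap.add_apply, mul_add, Finset.sum_add_distrib]

lemma wedgeEval_smul_right (h : k + l = N) (c : ℝ) (a : Alt X k) (b : Alt X l) (v : Fin N → X) :
    wedgeEval h a (c • b) v = c * wedgeEval h a b v := by
  simp only [wedgeEval, ContinuousAlternatingMap.smul_apply, Finset.mul_sum, smul_eq_mul]
  exact Finset.sum_congr rfl fun _ _ => by ring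

/-- The wedge product as a continuous bilinear map. -/
def wedge (h : k + l = N) : Alt X k →L[ℝ] Alt X l →L[ℝ] Alt X N :=
  LinearMap.mkContinuous₂ (LinearMap.mk₂ ℝ (wedge₀ h)
      (fun a a' b => by ext v; simp [wedge₀_apply, wedgeEval_add_left])
      (fun c a b => by ext v; simp [wedge₀_apply, wedgeEval_smul_left])
      (fun a b b' => by ext v; simp [wedge₀_apply, wedgeEval_add_right])
      (fun c a b => by ext v; simp [wedge₀_apply, wedgeEval_smul_right])) N.factorial
    fun a b => norm_wedge₀_le h a b

lemma wedge_apply (h : k + l = N) (a : Alt X k) (b : Alt X l) (v : Fin N → X) :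
    wedge h a b v = wedgeEval h a b v :=
  wedge₀_apply h a b v

/-! ### Graded commutativity -/

/-- The permutation of `Fin (k + l)` which moves the last `l` indices in front of the others. -/
def blockFlip (k l : ℕ) : Equiv.Perm (Fin (k + l)) :=
  finAddFlip.trans (finCongr (Nat.add_comm l k))

lemma finRotate_pow_apply_val (N l : ℕ) (i : Fin N) :
    ((finRotate N ^ l) i : ℕ) = (i + l) % N := by
  cases N with
  | zero => exact i.elim0
  | succ n =>
    induction l with
    | zero => simp [Nat.mod_eq_of_lt i.2]
    | succ l ih =>
      rw [pow_succ', Equiv.Perm.mul_apply, finRotate_apply, Fin.val_add, ih]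
      simp [← Nat.add_assoc]

lemma blockFlip_castAdd (k l : ℕ) (i : Fin k) :
    blockFlip k l (Fin.castAdd l i) = Fin.cast (Nat.add_comm l k) (Fin.natAdd l i) := by
  simp [blockFlip]

lemma blockFlip_natAdd (k l : ℕ) (j : Fin l) :
    blockFlip k l (Fin.natAdd k j) = Fin.cast (Nat.add_comm l k) (Fin.castAdd k j) := by
  simp [blockFlip]

/-- A block exchange is a cyclic shift, so its sign is a power of the known sign of `finRotate`. -/
lemma blockFlip_eq_pow (k l : ℕ) : blockFlip k l = finRotate (k + l) ^ l := by
  ext i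
  rw [finRotate_pow_apply_val]
  induction i using Fin.addCases with
  | left i =>
    rw [blockFlip_castAdd]
    have := i.2
    simp only [Fin.val_cast, Fin.val_natAdd, Fin.val_castAdd]
    rw [Nat.mod_eq_of_lt (by omega)]
    omega
  | right j =>
    rw [blockFlip_natAdd]
    have := j.2
    simp only [Fin.val_cast, Fin.val_natAdd, Fin.val_castAdd]
    rw [show k + (j : ℕ) + l = j + (k + l) by omega, Nat.add_mod_right,
      Nat.mod_eq_of_lt (by omega)]

lemma sign_blockFlip (k l : ℕ) : Equiv.Perm.sign (blockFlip k l) = (-1) ^ (k * l) := by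
  rw [blockFlip_eq_pow, map_pow, sign_finRotate, ← pow_mul]
  rcases l with _ | l
  · simp
  -- (k + l)(l + 1) = k(l + 1) + l(l + 1), and the last product is even.
  · rw [show k + (l + 1) - 1 = k + l by omega, add_mul, pow_add,
      (Nat.even_mul_succ_self l).neg_one_pow, mul_one]

/-- Graded commutativity of the wedge product. -/
lemma wedgeEval_comm (h : k + l = N) (a : Alt X k) (b : Alt X l) (v : Fin N → X) :
    wedgeEval h a b v = (-1) ^ (k * l) * wedgeEval ((Nat.add_comm l k).trans h) b a v := by
  subst h
  simp only [wedgeEval]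
  rw [mul_left_comm, mul_comm (l.factorial : ℝ)]
  congr 1
  rw [Finset.mul_sum]
  -- Composing each permutation with the block exchange swaps the argument blocks of `a` and `b` and
  -- costs its sign.
  rw [← Equiv.sum_comp (Equiv.mulRight (blockFlip k l))]
  refine Finset.sum_congr rfl fun σ _ => ?_
  simp only [Equiv.coe_mulRight, Equiv.Perm.sign_mul, sign_blockFlip, Equiv.Perm.mul_apply,
    Fin.cast_refl, id, blockFlip_castAdd, blockFlip_natAdd]
  push_cast
  ring

/-! ### The Leibniz rule -/

/-- The permutation of `Fin (N + 1)` which maps `0` to `i` and permutes the other indices by `τ`. -/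
def liftPerm (q : Fin (N + 1) × Equiv.Perm (Fin N)) : Equiv.Perm (Fin (N + 1)) :=
  q.1.cycleRange.symm * Equiv.Perm.decomposeFin.symm (0, q.2)

lemma liftPerm_zero (q : Fin (N + 1) × Equiv.Perm (Fin N)) : liftPerm q 0 = q.1 := by
  simp [liftPerm, Equiv.Perm.mul_apply]

lemma liftPerm_succ (q : Fin (N + 1) × Equiv.Perm (Fin N)) (j : Fin N) :
    liftPerm q j.succ = q.1.succAbove (q.2 j) := by
  simp [liftPerm, Equiv.Perm.mul_apply]

lemma sign_liftPerm (q : Fin (N + 1) × Equiv.Perm (Fin N)) :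
    Equiv.Perm.sign (liftPerm q) = (-1) ^ (q.1 : ℕ) * Equiv.Perm.sign q.2 := by
  simp [liftPerm, Equiv.Perm.sign_mul, Fin.sign_cycleRange, Equiv.Perm.sign_symm,
    Equiv.Perm.decomposeFin.symm_sign]

/-- The value at 0 recovers the index and the values at successors recover the permutation;
surjectivity follows by counting. This allows sums over permutations to be grouped by the image of
0. -/
lemma liftPerm_bijective : Function.Bijective (liftPerm (N := N)) := by
  rw [Fintype.bijective_iff_injective_and_card]
  constructor
  · rintro ⟨i, σ⟩ ⟨j, τ⟩ hq
    have h0 : i = j := by simpa [liftPerm_zero] using congrArg (fun e => e 0) hq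
    subst h0
    refine Prod.ext rfl (Equiv.ext fun x => ?_)
    have := congrArg (fun e => e x.succ) hq
    simpa [liftPerm_succ] using this
  · simp [Fintype.card_perm, Nat.factorial_succ]

/-- The wedge product with an alternatization, expanded along the first factor. -/
lemma wedgeEval_alternatize_left (h : k + 1 + l = N + 1) (A : X →L[ℝ] Alt X k) (b : Alt X l)
    (v : Fin (N + 1) → X) :
    wedgeEval h (ContinuousAlternatingMap.alternatizeUncurryFin A) b v =
      ∑ i : Fin (N + 1), (-1) ^ (i : ℕ) * wedgeEval (by omega : k + l = N) (A (v i)) b (i.removeNth v) := by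
  obtain rfl : N = k + l := by omega
  set F : Equiv.Perm (Fin (k + l + 1)) → ℝ := fun σ => ((Equiv.Perm.sign σ : ℤ) : ℝ) *
    A (v (σ 0)) (fun i => v (σ (Fin.castAdd l i).succ)) *
      b (fun j => v (σ (Fin.natAdd k j).succ)) with hF
  have hL : wedgeEval h (ContinuousAlternatingMap.alternatizeUncurryFin A) b v =
      (((k.factorial : ℝ) * (l.factorial : ℝ))⁻¹ * ∑ σ, F σ) := by
    -- The terms of the alternatization all give the same sum: composing with the cycle that carries
    -- slot `j` to the front relabels the arguments, and its sign cancels the sign of the term.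
    have hj : ∀ j : Fin (k + 1), ∑ σ : Equiv.Perm (Fin (k + l + 1)),
        ((Equiv.Perm.sign σ : ℤ) : ℝ) * ((-1) ^ (j : ℕ) *
          A (v (σ (Fin.cast h (Fin.castAdd l j))))
            (fun i => v (σ (Fin.cast h (Fin.castAdd l (j.succAbove i)))))) *
          b (fun i => v (σ (Fin.cast h (Fin.natAdd (k + 1) i)))) = ∑ σ, F σ := by
      intro j
      set j' : Fin (k + l + 1) := Fin.cast h (Fin.castAdd l j) with hj'
      rw [← Equiv.sum_comp (Equiv.mulRight j'.cycleRange)]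
      refine Finset.sum_congr rfl fun σ _ => ?_
      have e1 : ∀ i : Fin k, Fin.cast h (Fin.castAdd l (j.succAbove i)) =
          j'.succAbove (Fin.castAdd l i) := by
        intro i
        ext
        simp only [hj', Fin.succAbove, Fin.lt_def]
        split_ifs <;> simp_all <;> omega
      have e2 : ∀ i : Fin l, Fin.cast h (Fin.natAdd (k + 1) i) =
          j'.succAbove (Fin.natAdd k i) := by
        intro i
        ext
        have := j.2
        simp only [hj', Fin.succAbove, Fin.lt_def]
        split_ifs <;> simp_all <;> omega
      simp only [Equiv.coe_mulRight, Equiv.Perm.sign_mul, Equiv.Perm.mul_apply, e1, e2,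
        Fin.cycleRange_succAbove, Fin.cycleRange_self, Fin.sign_cycleRange, hF]
      have : (j' : ℕ) = j := rfl
      rw [this]
      push_cast
      have h1 : ((-1 : ℝ) ^ (j : ℕ)) * (-1) ^ (j : ℕ) = 1 := by rw [← mul_pow]; simp
      linear_combination (((Equiv.Perm.sign σ : ℤ) : ℝ) *
        A (v (σ 0)) (fun i => v (σ (Fin.castAdd l i).succ)) *
        b (fun j => v (σ (Fin.natAdd k j).succ))) * h1
    have hsum : ∑ σ : Equiv.Perm (Fin (k + l + 1)), ((Equiv.Perm.sign σ : ℤ) : ℝ) *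
        ContinuousAlternatingMap.alternatizeUncurryFin A
          (fun i => v (σ (Fin.cast h (Fin.castAdd l i)))) *
        b (fun j => v (σ (Fin.cast h (Fin.natAdd (k + 1) j)))) = (k + 1) * ∑ σ, F σ := by
      simp only [ContinuousAlternatingMap.alternatizeUncurryFin_apply, Finset.mul_sum,
        Finset.sum_mul]
      rw [Finset.sum_comm]
      have : ∀ j : Fin (k + 1), ∑ σ : Equiv.Perm (Fin (k + l + 1)),
          ((Equiv.Perm.sign σ : ℤ) : ℝ) * ((-1 : ℤ) ^ (j : ℕ) •
            A (v (σ (Fin.cast h (Fin.castAdd l j)))) (j.removeNth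
              (fun i => v (σ (Fin.cast h (Fin.castAdd l i)))))) *
            b (fun i => v (σ (Fin.cast h (Fin.natAdd (k + 1) i)))) = ∑ σ, F σ := by
        intro j
        rw [← hj j]
        refine Finset.sum_congr rfl fun σ _ => ?_
        rw [zsmul_eq_mul]
        push_cast
        rfl
      rw [Finset.sum_congr rfl fun j _ => this j]
      simp [Finset.mul_sum]
    -- The k + 1 equal contributions reduce 1/(k+1)! to 1/k!.
    rw [wedgeEval, hsum, Nat.factorial_succ, ← mul_assoc]
    congr 1
    push_cast
    have : (k : ℝ) + 1 ≠ 0 := by positivity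
    field_simp
  -- Group the permutations by the index that fills the derivative slot.
  rw [hL, ← liftPerm_bijective.sum_comp, Fintype.sum_prod_type, Finset.mul_sum]
  refine Finset.sum_congr rfl fun i _ => ?_
  rw [wedgeEval, mul_left_comm]
  congr 1
  rw [Finset.mul_sum]
  refine Finset.sum_congr rfl fun τ _ => ?_
  simp only [hF, liftPerm_zero, liftPerm_succ, sign_liftPerm, Fin.cast_refl, id, Fin.removeNth]
  push_cast
  ring

/-- The wedge product with an alternatization, expanded along the second factor. -/
lemma wedgeEval_alternatize_right (h : k + (l + 1) = N + 1) (a : Alt X k) (B : X →L[ℝ] Alt X l)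
    (v : Fin (N + 1) → X) :
    wedgeEval h a (ContinuousAlternatingMap.alternatizeUncurryFin B) v = (-1) ^ k *
      ∑ i : Fin (N + 1), (-1) ^ (i : ℕ) * wedgeEval (by omega : k + l = N) a (B (v i)) (i.removeNth v) := by
  -- Commuting to the left version and back costs (-1)^(k(l+1)) and (-1)^(lk), which leaves (-1)^k.
  rw [wedgeEval_comm, wedgeEval_alternatize_left]
  simp only [wedgeEval_comm (by omega : l + k = N), Finset.mul_sum]
  refine Finset.sum_congr rfl fun i _ => ?_
  have : ((-1 : ℝ) ^ (k * l)) * (-1) ^ (l * k) = 1 := by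
    rw [mul_comm l k, ← mul_pow]; simp
  rw [mul_add, pow_add, mul_one]
  linear_combination (-1) ^ k * (-1) ^ (i : ℕ) * wedgeEval (by omega : k + l = N) a (B (v i))
    (i.removeNth v) * this

/-- The Leibniz rule for the exterior derivative of a wedge product. -/
lemma extDeriv_wedge (h : k + l = N) {a : X → Alt X k} {b : X → Alt X l} {x : X}
    (ha : DifferentiableAt ℝ a x) (hb : DifferentiableAt ℝ b x) (v : Fin (N + 1) → X) :
    extDeriv (fun y => wedge h (a y) (b y)) x v =
      wedgeEval (by omega : k + 1 + l = N + 1) (extDeriv a x) (b x) v +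
        (-1) ^ k * wedgeEval (by omega : k + (l + 1) = N + 1) (a x) (extDeriv b x) v := by
  have hd := (wedge h).hasFDerivAt_of_bilinear ha.hasFDerivAt hb.hasFDerivAt
  rw [extDeriv, hd.fderiv, ContinuousAlternatingMap.alternatizeUncurryFin_apply, extDeriv, extDeriv,
    wedgeEval_alternatize_left, wedgeEval_alternatize_right, ← mul_assoc, ← mul_pow]
  simp only [mul_neg, mul_one, neg_neg, one_pow, one_mul, ← Finset.sum_add_distrib]
  refine Finset.sum_congr rfl fun i _ => ?_
  simp [wedge_apply, zsmul_eq_mul]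
  ring

end Wedge

end

end PortHam

open MeasureTheory Set Filter Topology

namespace PortHam

noncomputable section

/-! ### The divergence theorem on a Lipschitz subgraph -/

section Subgraph

variable {m : ℕ} {K : NNReal} {h : (Fin m → ℝ) → ℝ}

/-- The shear `(s, y) ↦ (s + h y, y)` as a homeomorphism. -/
def shear (hh : Continuous h) : (ℝ × (Fin m → ℝ)) ≃ₜ (ℝ × (Fin m → ℝ)) where
  toFun p := (p.1 + h p.2, p.2)
  invFun p := (p.1 - h p.2, p.2)
  left_inv p := by simp
  right_inv p := by simp
  continuous_toFun := by fun_prop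
  continuous_invFun := by fun_prop

/-- Shifting each vertical line by `h y` straightens the subgraph to a fixed half-space, so that
Fubini can later be used in either order without `h` in the limits. -/
lemma integral_subgraph_eq (hh : Continuous h) {g : ℝ × (Fin m → ℝ) → ℝ} (hg : Continuous g)
    (hc : HasCompactSupport g) :
    ∫ p in {p : ℝ × (Fin m → ℝ) | p.1 ≤ h p.2}, g p =
      ∫ y, ∫ s in Iic (0 : ℝ), g (s + h y, y) := by
  have hmeas : MeasurableSet {p : ℝ × (Fin m → ℝ) | p.1 ≤ h p.2} :=
    (isClosed_le continuous_fst (hh.comp continuous_snd)).measurableSet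
  rw [← integral_indicator hmeas, Measure.volume_eq_prod, integral_prod_symm]
  · refine integral_congr_ae (.of_forall fun y => ?_)
    simp only
    rw [← integral_add_right_eq_self _ (h y), ← integral_indicator measurableSet_Iic]
    refine integral_congr_ae (.of_forall fun s => ?_)
    simp [indicator]
  · exact (hg.integrable_of_hasCompactSupport hc).indicator hmeas

/-- On a slice parallel to the graph, the restriction of `Z` is Lipschitz with compact support, so
its directional derivative integrates to zero. The chain rule, valid almost everywhere by
Rademacher's theorem, splits that derivative into the two integrands. -/
lemma integral_fderiv_slice_eq (hh : LipschitzWith K h) {Z : ℝ × (Fin m → ℝ) → ℝ}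
    (hZ : ContDiff ℝ 1 Z) (hc : HasCompactSupport Z) (w : Fin m → ℝ) (s : ℝ) :
    ∫ y, fderiv ℝ Z (s + h y, y) (0, w) =
      ∫ y, -(fderiv ℝ h y w * fderiv ℝ Z (s + h y, y) (1, 0)) := by
  obtain ⟨L, hL⟩ := hZ.lipschitzWith_of_hasCompactSupport hc (by simp)
  have hsl : LipschitzWith (max K 1) fun y : Fin m → ℝ => (s + h y, y) := by
    refine LipschitzWith.prodMk ?_ LipschitzWith.id
    simpa using (LipschitzWith.const s).add hh
  have hW := hL.comp hsl
  have hWc : HasCompactSupport (Z ∘ fun y : Fin m → ℝ => (s + h y, y)) := by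
    refine HasCompactSupport.intro (hc.isCompact.image continuous_snd) fun y hy => ?_
    by_contra hne
    exact hy ⟨_, subset_tsupport _ hne, rfl⟩
  -- Integration by parts against the constant 1; the direction is `-w` because the rule reverses it
  -- on the other factor.
  have h0 := LipschitzWith.integral_lineDeriv_mul_eq (μ := volume) (LipschitzWith.const (1 : ℝ)) hW hWc (-w)
  have hae : ∀ᵐ y, lineDeriv ℝ (Z ∘ fun y : Fin m → ℝ => (s + h y, y)) y w =
      fderiv ℝ Z (s + h y, y) (0, w) + fderiv ℝ h y w * fderiv ℝ Z (s + h y, y) (1, 0) := by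
    filter_upwards [hh.ae_differentiableAt] with y hy
    have h1 : HasFDerivAt (fun y : Fin m → ℝ => (s + h y, y))
        ((fderiv ℝ h y).prod (ContinuousLinearMap.id ℝ _)) y :=
      (hy.hasFDerivAt.const_add s).prodMk (hasFDerivAt_id y)
    have h2 := HasFDerivAt.comp (g := Z) (f := fun y : Fin m → ℝ => (s + h y, y)) y
      ((hZ.differentiable (by simp)) (s + h y, y)).hasFDerivAt h1
    rw [h2.hasLineDerivAt w |>.lineDeriv]
    have : ((fderiv ℝ h y w, w) : ℝ × (Fin m → ℝ)) = (0, w) + fderiv ℝ h y w • (1, 0) := by simp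
    simp only [ContinuousLinearMap.comp_apply, ContinuousLinearMap.prod_apply,
      ContinuousLinearMap.id_apply]
    rw [this, map_add, map_smul, smul_eq_mul]
  have hcomp : Continuous fun y : Fin m → ℝ => (s + h y, y) := hsl.continuous
  have hint : ∀ v, Integrable fun y => fderiv ℝ Z (s + h y, y) v := by
    intro v
    refine Continuous.integrable_of_hasCompactSupport
      (((hZ.continuous_fderiv (by simp)).comp hcomp).clm_apply continuous_const) ?_
    refine HasCompactSupport.intro (hc.isCompact.image continuous_snd) fun y hy => ?_
    have : (s + h y, y) ∉ tsupport (fderiv ℝ Z) := fun hm =>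
      hy ⟨_, tsupport_fderiv_subset ℝ hm, rfl⟩
    simp [image_eq_zero_of_notMem_tsupport this]
  have hbd : Integrable fun y => fderiv ℝ h y w * fderiv ℝ Z (s + h y, y) (1, 0) := by
    refine (hint (1, 0)).bdd_mul (c := K * ‖w‖) (measurable_fderiv_apply_const ℝ h w).aestronglyMeasurable
      (.of_forall fun y => ?_)
    exact (fderiv ℝ h y).le_of_opNorm_le (norm_fderiv_le_of_lipschitz ℝ hh) w
  have h3 : ∫ y, (fderiv ℝ Z (s + h y, y) (0, w) +
      fderiv ℝ h y w * fderiv ℝ Z (s + h y, y) (1, 0)) = 0 := by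
    rw [← integral_congr_ae hae]
    simpa [lineDeriv] using h0.symm
  rw [integral_add (hint _) hbd] at h3
  rw [integral_neg]
  linarith

/-- Fundamental theorem of calculus on a half-line; compact support removes the contribution at -∞.
-/
lemma integral_Iic_fderiv_fst {Z : ℝ × (Fin m → ℝ) → ℝ} (hZ : ContDiff ℝ 1 Z)
    (hc : HasCompactSupport Z) (b : ℝ) (y : Fin m → ℝ) :
    ∫ s in Iic (0 : ℝ), fderiv ℝ Z (s + b, y) (1, 0) = Z (b, y) := by
  have hcd : ContDiff ℝ 1 fun s : ℝ => Z (s + b, y) := hZ.comp (by fun_prop)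
  have hcs : HasCompactSupport fun s : ℝ => Z (s + b, y) := by
    refine HasCompactSupport.intro ((hc.isCompact.image continuous_fst).image
      (f := fun s => s - b) (by fun_prop)) fun s hs => ?_
    by_contra hne
    exact hs ⟨s + b, ⟨_, subset_tsupport _ hne, rfl⟩, by simp⟩
  have := hcs.integral_Iic_deriv_eq hcd 0
  rw [zero_add] at this
  rw [← this]
  refine setIntegral_congr_fun measurableSet_Iic fun s _ => ?_
  have h1 : HasDerivAt (fun s : ℝ => (s + b, y)) ((1 : ℝ), (0 : Fin m → ℝ)) s :=
    ((hasDerivAt_id s).add_const b).prodMk (hasDerivAt_const s y)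
  have h2 := ((hZ.differentiable (by simp)) (s + b, y)).hasFDerivAt.comp_hasDerivAt s h1
  exact h2.deriv.symm

/-- The divergence theorem on the subgraph of a Lipschitz function, for one direction. -/
lemma integral_fderiv_subgraph (hh : LipschitzWith K h) {Z : ℝ × (Fin m → ℝ) → ℝ}
    (hZ : ContDiff ℝ 1 Z) (hc : HasCompactSupport Z) (σ : ℝ) (w : Fin m → ℝ) :
    ∫ p in {p : ℝ × (Fin m → ℝ) | p.1 ≤ h p.2}, fderiv ℝ Z p (σ, w) =
      ∫ y, Z (h y, y) * (σ - fderiv ℝ h y w) := by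
  have hcont : ∀ v, Continuous fun p => fderiv ℝ Z p v := fun v =>
    (hZ.continuous_fderiv (by simp)).clm_apply continuous_const
  have hsupp : ∀ v, HasCompactSupport fun p => fderiv ℝ Z p v := fun v => hc.fderiv_apply ℝ v
  have hcont' : ∀ v, Continuous fun p : ℝ × (Fin m → ℝ) => fderiv ℝ Z (p.1 + h p.2, p.2) v :=
    fun v => (hcont v).comp (shear hh.continuous).continuous
  have hsupp' : ∀ v, HasCompactSupport
      fun p : ℝ × (Fin m → ℝ) => fderiv ℝ Z (p.1 + h p.2, p.2) v :=
    fun v => (hsupp v).comp_homeomorph (shear hh.continuous)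
  have hint : ∀ v, Integrable (fun p : ℝ × (Fin m → ℝ) => fderiv ℝ Z (p.1 + h p.2, p.2) v)
      ((volume.restrict (Iic (0 : ℝ))).prod volume) := by
    intro v
    have := ((hcont' v).integrable_of_hasCompactSupport (hsupp' v) (μ := volume)).restrict
      (s := Iic 0 ×ˢ univ)
    rwa [Measure.volume_eq_prod, ← Measure.prod_restrict, Measure.restrict_univ] at this
  have hint2 : Integrable (fun p : ℝ × (Fin m → ℝ) =>
      -(fderiv ℝ h p.2 w * fderiv ℝ Z (p.1 + h p.2, p.2) (1, 0)))
      ((volume.restrict (Iic (0 : ℝ))).prod volume) := by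
    refine ((hint (1, 0)).bdd_mul (c := K * ‖w‖)
      ((measurable_fderiv_apply_const ℝ h w).comp measurable_snd).aestronglyMeasurable
      (.of_forall fun p => ?_)).neg
    exact (fderiv ℝ h p.2).le_of_opNorm_le (norm_fderiv_le_of_lipschitz ℝ hh) w
  rw [integral_subgraph_eq hh.continuous (hcont _) (hsupp _)]
  -- Fubini puts `y` inside, where the slice identity trades the horizontal derivative for a
  -- vertical one, which can be integrated exactly.
  have hw : ∫ y, ∫ s in Iic (0 : ℝ), fderiv ℝ Z (s + h y, y) (0, w) =
      ∫ y, ∫ s in Iic (0 : ℝ), -(fderiv ℝ h y w * fderiv ℝ Z (s + h y, y) (1, 0)) := by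
    rw [← integral_prod_symm _ (hint (0, w)), ← integral_prod_symm _ hint2,
      integral_prod _ (hint (0, w)), integral_prod _ hint2]
    exact integral_congr_ae (.of_forall fun s => integral_fderiv_slice_eq hh hZ hc w s)
  have hsplit : ∀ p, fderiv ℝ Z p (σ, w) = σ * fderiv ℝ Z p (1, 0) + fderiv ℝ Z p (0, w) := by
    intro p
    have : ((σ, w) : ℝ × (Fin m → ℝ)) = σ • (1, 0) + (0, w) := by simp
    rw [this, map_add, map_smul, smul_eq_mul]
  have e1 : ∫ y, ∫ s in Iic (0 : ℝ), fderiv ℝ Z (s + h y, y) (σ, w) =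
      (∫ y, ∫ s in Iic (0 : ℝ), σ * fderiv ℝ Z (s + h y, y) (1, 0)) +
        ∫ y, ∫ s in Iic (0 : ℝ), fderiv ℝ Z (s + h y, y) (0, w) := by
    rw [← integral_prod_symm _ ((hint (1, 0)).const_mul σ), ← integral_prod_symm _ (hint (0, w)),
      ← integral_prod_symm _ (hint (σ, w)),
      ← integral_add ((hint (1, 0)).const_mul σ) (hint (0, w))]
    exact integral_congr_ae (.of_forall fun p => hsplit _)
  have hZi : Integrable fun y => Z (h y, y) := by
    refine Continuous.integrable_of_hasCompactSupport
      (hZ.continuous.comp (hh.continuous.prodMk continuous_id)) ?_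
    refine HasCompactSupport.intro (hc.isCompact.image continuous_snd) fun y hy => ?_
    by_contra hne
    exact hy ⟨_, subset_tsupport _ hne, rfl⟩
  have hZi2 : Integrable fun y => fderiv ℝ h y w * Z (h y, y) := by
    refine hZi.bdd_mul (c := K * ‖w‖) (measurable_fderiv_apply_const ℝ h w).aestronglyMeasurable
      (.of_forall fun y => ?_)
    exact (fderiv ℝ h y).le_of_opNorm_le (norm_fderiv_le_of_lipschitz ℝ hh) w
  rw [e1, hw]
  simp only [integral_neg, integral_const_mul, integral_Iic_fderiv_fst hZ hc]
  rw [← sub_eq_add_neg, ← integral_const_mul, ← integral_sub (hZi.const_mul σ) hZi2]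
  exact integral_congr_ae (.of_forall fun y => by ring)

end Subgraph

end

end PortHam

open MeasureTheory Set Filter Topology

namespace PortHam

noncomputable section

/-! ### Stokes' theorem on Lipschitz domains -/

section Tangent

variable {X : Type} [NormedAddCommGroup X] [NormedSpace ℝ X] {m : ℕ}

/-- In the multilinear expansion, every term that picks some `c j • u` contains `u` in two slots up
to a scalar and vanishes. -/
lemma map_cons_add_smul_head (Λ : Alt X (m + 1)) (u : X) (w : Fin m → X) (c : Fin m → ℝ) :
    Λ (Fin.cons u (fun j => w j + c j • u)) = Λ (Fin.cons u w) := by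
  have hΛ : ∀ v, Λ (Fin.cons u v) = Λ.toAlternatingMap.curryLeft u v := fun v => rfl
  rw [hΛ, hΛ]
  change Λ.toAlternatingMap.curryLeft u (w + fun j => c j • u) = _
  rw [AlternatingMap.map_add_univ, Finset.sum_eq_single Finset.univ]
  · simp
  · intro s _ hs
    obtain ⟨j, hj⟩ : ∃ j, j ∉ s := by
      by_contra! hall
      exact hs (Finset.eq_univ_iff_forall.2 hall)
    set v := s.piecewise w fun j => c j • u with hv
    have h1 : v = Function.update v j (c j • u) := by
      rw [eq_comm, Function.update_eq_self_iff]
      simp [hv, hj]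
    rw [h1, AlternatingMap.map_update_smul, ← hΛ, Λ.map_eq_zero_of_eq (i := 0) (j := j.succ)]
    · simp
    · simp
    · exact (Fin.succ_ne_zero j).symm
  · simp

/-- An alternating form evaluated on the tangent vectors of a graph. -/
lemma map_graph_tangent (μ : Alt X m) (L : X →L[ℝ] ℝ) (u : Fin (m + 1) → X) (c : Fin m → ℝ)
    (h0 : L (u 0) = 1) (hc : ∀ j : Fin m, L (u j.succ) = -c j) :
    μ (fun j => u j.succ + c j • u 0) =
      ∑ i : Fin (m + 1), (-1) ^ (i : ℕ) * L (u i) * μ (i.removeNth u) := by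
  -- Apply it to the (m+1)-form L ∧ μ. The shifted vectors lie in the kernel of `L`, so one side
  -- keeps only the index 0, while the other is the full alternating sum.
  have h1 := map_cons_add_smul_head
    (ContinuousAlternatingMap.alternatizeUncurryFin (L.smulRight μ)) (u 0)
    (fun j => u j.succ) c
  have h2 : (Fin.cons (u 0) fun j : Fin m => u j.succ : Fin (m + 1) → X) = u :=
    Fin.cons_self_tail u
  rw [h2, ContinuousAlternatingMap.alternatizeUncurryFin_apply,
    ContinuousAlternatingMap.alternatizeUncurryFin_apply, Fin.sum_univ_succ] at h1
  have h3 : ∀ j : Fin m, L (u j.succ + c j • u 0) = 0 := fun j => by simp [h0, hc]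
  simp only [ContinuousLinearMap.smulRight_apply, Fin.cons_zero, Fin.cons_succ, h3,
    h0, zero_smul, ContinuousAlternatingMap.coe_zero, Pi.zero_apply, smul_zero,
    Finset.sum_const_zero, add_zero, Fin.val_zero, pow_zero, one_smul, Fin.removeNth_zero,
    Fin.tail_cons] at h1
  rw [h1]
  refine Finset.sum_congr rfl fun i _ => ?_
  simp [mul_assoc]

end Tangent

variable {m : ℕ} {T : Set (Space m)}

/-- The standard basis of the ambient space. -/
def stdBasis (m : ℕ) : Module.Basis (Fin (m + 1)) ℝ (Space m) :=
  (EuclideanSpace.basisFun (Fin (m + 1)) ℝ).toBasis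

lemma coe_stdBasis (m : ℕ) : (stdBasis m : Fin (m + 1) → Space m) = stdVec m := by
  ext i : 1
  simp [stdBasis, stdVec]

/-- Top forms are multiples of the determinant; this is the source of the orientation sign of a
chart. -/
lemma map_stdVec_eq_det_mul (η : Alt (Space m) (m + 1)) (f : Space m ≃ₗᵢ[ℝ] Space m) :
    η (stdVec m) = LinearMap.det (f.toLinearEquiv : Space m →ₗ[ℝ] Space m) *
      η (fun i => f.symm (stdVec m i)) := by
  have h1 : ∀ v, η v = η (stdVec m) * (stdBasis m).det v := by
    intro v
    have := congrArg (fun F => F v) (η.toAlternatingMap.eq_smul_basis_det (stdBasis m))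
    rw [coe_stdBasis] at this
    simpa using this
  have h2 : (stdBasis m).det (fun i => f.symm (stdVec m i)) =
      LinearMap.det (f.symm.toLinearEquiv : Space m →ₗ[ℝ] Space m) := by
    have := (stdBasis m).det_comp (f.symm.toLinearEquiv : Space m →ₗ[ℝ] Space m) (stdBasis m)
    rw [Module.Basis.det_self, mul_one, coe_stdBasis] at this
    exact this
  have h3 : LinearMap.det (f.toLinearEquiv : Space m →ₗ[ℝ] Space m) *
      LinearMap.det (f.symm.toLinearEquiv : Space m →ₗ[ℝ] Space m) = 1 :=
    f.toLinearEquiv.det_mul_det_symm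
  rw [h1 (fun i => f.symm (stdVec m i)), h2]
  linear_combination (-η (stdVec m)) * h3

/-- The linear coordinates `(y₀, (y₁, …, y_m)) ↦ x` of a chart. -/
def LipschitzChart.coord (c : LipschitzChart T) : (ℝ × (Fin m → ℝ)) ≃L[ℝ] Space m :=
  ((Fin.consEquivL ℝ (fun _ : Fin (m + 1) => ℝ)).trans
    (PiLp.continuousLinearEquiv 2 ℝ (fun _ : Fin (m + 1) => ℝ)).symm).trans
    c.frame.symm.toContinuousLinearEquiv

lemma LipschitzChart.coord_apply (c : LipschitzChart T) (p : ℝ × (Fin m → ℝ)) :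
    c.coord p = c.frame.symm (WithLp.toLp 2 (Fin.cons p.1 p.2)) := rfl

lemma LipschitzChart.param_eq_coord (c : LipschitzChart T) (y : Fin m → ℝ) :
    c.param y = c.coord (c.height y, y) := rfl

lemma LipschitzChart.coord_measurePreserving (c : LipschitzChart T) :
    MeasurePreserving c.coord := by
  have h1 : MeasurePreserving (MeasurableEquiv.piFinSuccAbove (fun _ : Fin (m + 1) => ℝ) 0).symm :=
    (volume_preserving_piFinSuccAbove (fun _ : Fin (m + 1) => ℝ) 0).symm _
  have h2 := (c.frame.symm.measurePreserving.comp
    (PiLp.volume_preserving_toLp (Fin (m + 1)))).comp h1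
  convert h2 using 1
  ext p : 1
  simp only [coord_apply, Function.comp_apply]
  congr 2
  simp [MeasurableEquiv.piFinSuccAbove, Fin.insertNthEquiv]

lemma LipschitzChart.coord_mem_iff (c : LipschitzChart T) (p : ℝ × (Fin m → ℝ))
    (hp : c.coord p ∈ c.U) : c.coord p ∈ T ↔ p.1 ≤ c.height p.2 := by
  rw [c.mem_iff _ hp]
  simp [coord_apply]

lemma LipschitzChart.height_continuous (c : LipschitzChart T) : Continuous c.height :=
  c.lipschitz.choose_spec.continuous

lemma LipschitzChart.param_continuous (c : LipschitzChart T) : Continuous c.param :=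
  c.coord.continuous.comp (c.height_continuous.prodMk continuous_id)

lemma LipschitzChart.coord_basis_zero (c : LipschitzChart T) :
    c.coord (1, 0) = c.frame.symm (stdVec m 0) := by
  rw [coord_apply]
  congr 1
  ext i
  refine Fin.cases ?_ (fun j => ?_) i <;> simp [stdVec]

lemma LipschitzChart.coord_basis_succ (c : LipschitzChart T) (j : Fin m) :
    c.coord (0, Pi.single j 1) = c.frame.symm (stdVec m j.succ) := by
  rw [coord_apply]
  congr 1
  ext i
  refine Fin.cases ?_ (fun j => ?_) i <;>
    simp [stdVec, Pi.single_apply, (Fin.succ_ne_zero _).symm]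

lemma LipschitzChart.fderiv_param (c : LipschitzChart T) {y : Fin m → ℝ}
    (hy : DifferentiableAt ℝ c.height y) (j : Fin m) :
    fderiv ℝ c.param y (Pi.single j 1) = c.frame.symm (stdVec m j.succ) +
      fderiv ℝ c.height y (Pi.single j 1) • c.frame.symm (stdVec m 0) := by
  have h1 : HasFDerivAt (fun y => (c.height y, y))
      ((fderiv ℝ c.height y).prod (ContinuousLinearMap.id ℝ _)) y :=
    hy.hasFDerivAt.prodMk (hasFDerivAt_id y)
  have h2 := HasFDerivAt.comp (g := c.coord) (f := fun y => (c.height y, y)) y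
    c.coord.hasFDerivAt h1
  have h3 : fderiv ℝ c.param y = _ := h2.fderiv
  rw [h3, ← c.coord_basis_succ, ← c.coord_basis_zero, ← map_smul, ← map_add]
  simp

/-- Stokes' theorem for forms supported in one chart. -/
lemma LipschitzChart.integral_extDeriv (c : LipschitzChart T) (hT : MeasurableSet T)
    {ω : FormField m m} (hω : ContDiff ℝ 1 ω) (hc : HasCompactSupport ω)
    (hs : tsupport ω ⊆ c.U) :
    ∫ x in T, extDeriv ω x (stdVec m) =
      c.orient * ∫ y, ω (c.param y) (fun e => fderiv ℝ c.param y (Pi.single e 1)) := by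
  obtain ⟨K, hK⟩ := c.lipschitz
  set u : Fin (m + 1) → Space m := fun i => c.frame.symm (stdVec m i) with hu
  set b : Fin (m + 1) → ℝ × (Fin m → ℝ) := Fin.cons (1, 0) (fun j => (0, Pi.single j 1)) with hb
  have hbu : ∀ i, c.coord (b i) = u i := by
    intro i
    refine Fin.cases ?_ (fun j => ?_) i
    · simp [hb, hu, c.coord_basis_zero]
    · simp [hb, hu, c.coord_basis_succ]
  -- Coefficients of ω in the frame of the chart; dω is the alternating sum of their derivatives
  -- along `b i`, each of which is treated by `integral_fderiv_subgraph`.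
  set Z : Fin (m + 1) → ℝ × (Fin m → ℝ) → ℝ := fun i p => ω (c.coord p) (i.removeNth u) with hZ
  have hZd : ∀ i, ContDiff ℝ 1 (Z i) := fun i =>
    (ContinuousAlternatingMap.apply ℝ (Space m) ℝ (i.removeNth u)).contDiff.comp
      (hω.comp c.coord.contDiff)
  have hZc : ∀ i, HasCompactSupport (Z i) := fun i =>
    (hc.comp_homeomorph c.coord.toHomeomorph).comp_left
      (g := fun A : Alt (Space m) m => A (i.removeNth u)) rfl
  have hZf : ∀ i p v, fderiv ℝ (Z i) p v = fderiv ℝ ω (c.coord p) (c.coord v) (i.removeNth u) := by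
    intro i p v
    have h1 := ((ContinuousAlternatingMap.apply ℝ (Space m) ℝ (i.removeNth u)).hasFDerivAt.comp p
      ((hω.differentiable (by simp) (c.coord p)).hasFDerivAt.comp p c.coord.hasFDerivAt))
    have h2 : fderiv ℝ (Z i) p = _ := h1.fderiv
    rw [h2]
    rfl
  have hext : ∀ p, extDeriv ω (c.coord p) (stdVec m) =
      c.orient * ∑ i : Fin (m + 1), (-1) ^ (i : ℕ) * fderiv ℝ (Z i) p (b i) := by
    intro p
    rw [map_stdVec_eq_det_mul _ c.frame, LipschitzChart.orient, extDeriv,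
      ContinuousAlternatingMap.alternatizeUncurryFin_apply]
    congr 1
    refine Finset.sum_congr rfl fun i _ => ?_
    rw [hZf, hbu]
    simp [hu]
  have hmeas : MeasurableSet {p : ℝ × (Fin m → ℝ) | p.1 ≤ c.height p.2} :=
    (isClosed_le continuous_fst (c.height_continuous.comp continuous_snd)).measurableSet
  have hL : ∫ x in T, extDeriv ω x (stdVec m) =
      ∫ p in {p : ℝ × (Fin m → ℝ) | p.1 ≤ c.height p.2}, extDeriv ω (c.coord p) (stdVec m) := by
    rw [← integral_indicator hT, ← integral_indicator hmeas,
      ← c.coord_measurePreserving.integral_comp c.coord.toHomeomorph.measurableEmbedding]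
    refine integral_congr_ae (.of_forall fun p => ?_)
    -- Where the chart does not describe `T`, the integrand vanishes because ω is supported in
    -- `c.U`.
    by_cases hp : c.coord p ∈ c.U
    · simp only [indicator, c.coord_mem_iff p hp, mem_ofPred_eq]
    · have : extDeriv ω (c.coord p) = 0 := by
        have h0 : fderiv ℝ ω (c.coord p) = 0 :=
          image_eq_zero_of_notMem_tsupport fun hm => hp (hs (tsupport_fderiv_subset ℝ hm))
        rw [extDeriv, h0]
        exact map_zero (ContinuousAlternatingMap.alternatizeUncurryFinCLM ℝ (Space m) ℝ)
      simp [indicator, this]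
  have hint : ∀ i, IntegrableOn (fun p => fderiv ℝ (Z i) p (b i))
      {p : ℝ × (Fin m → ℝ) | p.1 ≤ c.height p.2} := fun i =>
    (Continuous.integrable_of_hasCompactSupport
      (((hZd i).continuous_fderiv (by simp)).clm_apply continuous_const)
      ((hZc i).fderiv_apply ℝ (b i))).integrableOn
  rw [hL]
  simp only [hext, integral_const_mul]
  congr 1
  rw [integral_finsetSum _ fun i _ => (hint i).const_mul _]
  simp only [integral_const_mul]
  have hσ : ∀ i, ∫ p in {p : ℝ × (Fin m → ℝ) | p.1 ≤ c.height p.2}, fderiv ℝ (Z i) p (b i) =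
      ∫ y, Z i (c.height y, y) * ((b i).1 - fderiv ℝ c.height y (b i).2) := fun i =>
    integral_fderiv_subgraph hK (hZd i) (hZc i) (b i).1 (b i).2
  have hint2 : ∀ i, Integrable fun y => Z i (c.height y, y) *
      ((b i).1 - fderiv ℝ c.height y (b i).2) := by
    intro i
    have hZi : Integrable fun y => Z i (c.height y, y) := by
      refine Continuous.integrable_of_hasCompactSupport
        ((hZd i).continuous.comp (c.height_continuous.prodMk continuous_id)) ?_
      refine HasCompactSupport.intro ((hZc i).isCompact.image continuous_snd) fun y hy => ?_
      by_contra hne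
      exact hy ⟨_, subset_tsupport _ hne, rfl⟩
    refine hZi.mul_bdd (c := ‖(b i).1‖ + K * ‖(b i).2‖)
      (measurable_const.sub (measurable_fderiv_apply_const ℝ c.height _)).aestronglyMeasurable
      (.of_forall fun y => (norm_sub_le _ _).trans ?_)
    gcongr
    exact (fderiv ℝ c.height y).le_of_opNorm_le (norm_fderiv_le_of_lipschitz ℝ hK) _
  simp only [hσ, ← integral_const_mul]
  rw [← integral_finsetSum _ fun i _ => (hint2 i).const_mul _]
  refine integral_congr_ae ?_
  filter_upwards [hK.ae_differentiableAt] with y hy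
  simp only [c.fderiv_param hy]
  -- The conormal of the graph: it annihilates the tangent vectors, and its values on `u` are the
  -- weights produced by the divergence theorem.
  set L : Space m →L[ℝ] ℝ := (ContinuousLinearMap.fst ℝ ℝ (Fin m → ℝ) -
    (fderiv ℝ c.height y).comp (ContinuousLinearMap.snd ℝ ℝ (Fin m → ℝ))).comp
      (c.coord.symm : Space m →L[ℝ] ℝ × (Fin m → ℝ)) with hLdef
  have hLu : ∀ i, L (u i) = (b i).1 - fderiv ℝ c.height y (b i).2 := by
    intro i
    rw [← hbu]
    simp [hLdef]
  rw [map_graph_tangent (ω (c.param y)) L u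
    (fun j => fderiv ℝ c.height y (Pi.single j 1)) (by rw [hLu]; simp [hb])
    (fun j => by rw [hLu]; simp [hb])]
  refine Finset.sum_congr rfl fun i _ => ?_
  rw [hLu]
  simp only [hZ, c.param_eq_coord]
  ring

/-- The integral of an exact form with compact support vanishes. -/
lemma integral_extDeriv_eq_zero {ω : FormField m m} (hω : ContDiff ℝ 1 ω)
    (hc : HasCompactSupport ω) : ∫ x, extDeriv ω x (stdVec m) = 0 := by
  have hint : ∀ i : Fin (m + 1),
      Integrable fun x => fderiv ℝ ω x (stdVec m i) (i.removeNth (stdVec m)) := by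
    intro i
    refine Continuous.integrable_of_hasCompactSupport ?_ ?_
    · exact (ContinuousAlternatingMap.apply ℝ (Space m) ℝ (i.removeNth (stdVec m))).continuous.comp
        ((hω.continuous_fderiv (by simp)).clm_apply continuous_const)
    · exact (hc.fderiv_apply ℝ (stdVec m i)).comp_left
        (g := fun A : Alt (Space m) m => A (i.removeNth (stdVec m))) rfl
  have h0 : ∀ i : Fin (m + 1),
      ∫ x, fderiv ℝ ω x (stdVec m i) (i.removeNth (stdVec m)) = 0 := by
    intro i
    set ev := ContinuousAlternatingMap.apply ℝ (Space m) ℝ (i.removeNth (stdVec m))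
    set g : Space m → ℝ := fun x => ω x (i.removeNth (stdVec m)) with hg
    have hgd : ContDiff ℝ 1 g := ev.contDiff.comp hω
    have hgc : HasCompactSupport g :=
      hc.comp_left (g := fun A : Alt (Space m) m => A (i.removeNth (stdVec m))) rfl
    have hgf : ∀ x, fderiv ℝ ω x (stdVec m i) (i.removeNth (stdVec m)) =
        fderiv ℝ g x (stdVec m i) := by
      intro x
      have h2 : fderiv ℝ g x = _ :=
        (ev.hasFDerivAt.comp x (hω.differentiable (by simp) x).hasFDerivAt).fderiv
      rw [h2]
      rfl
    have := integral_mul_fderiv_eq_neg_fderiv_mul_of_integrable (μ := volume) (𝕜 := ℝ)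
      (f := fun _ : Space m => (1 : ℝ)) (g := g) (v := stdVec m i) (by simp)
      (by simpa [hgf] using hint i)
      (by simpa using hgd.continuous.integrable_of_hasCompactSupport hgc)
      (fun x _ => by fun_prop) (fun x _ => hgd.differentiable (by simp) x)
    simpa [hgf] using this
  have h1 : ∀ x, extDeriv ω x (stdVec m) =
      ∑ i : Fin (m + 1), (-1) ^ (i : ℕ) * fderiv ℝ ω x (stdVec m i) (i.removeNth (stdVec m)) := by
    intro x
    rw [extDeriv, ContinuousAlternatingMap.alternatizeUncurryFin_apply]
    exact Finset.sum_congr rfl fun i _ => by simp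
  simp only [h1]
  rw [integral_finsetSum _ fun i _ => (hint i).const_mul _]
  simp [integral_const_mul, h0]

lemma extDeriv_eq_zero_of_eventuallyEq {k : ℕ} {ω : FormField m k} {x : Space m}
    (h : ω =ᶠ[𝓝 x] 0) : extDeriv ω x = 0 := by
  rw [h.extDeriv_eq, extDeriv]
  have : fderiv ℝ (0 : FormField m k) x = 0 := by
    simp
  rw [this]
  exact map_zero (ContinuousAlternatingMap.alternatizeUncurryFinCLM ℝ (Space m) ℝ)

/-- Stokes' theorem on a compact set for forms which vanish near its boundary. -/
lemma setIntegral_extDeriv_eq_zero (hT : IsCompact T) {ω : FormField m m} (hω : ContDiff ℝ 1 ω)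
    (h0 : ∀ᶠ x in 𝓝ˢ (frontier T), ω x = 0) : ∫ x in T, extDeriv ω x (stdVec m) = 0 := by
  have hfr : ∀ x ∈ frontier T, ω =ᶠ[𝓝 x] 0 := fun x hx => (eventually_nhdsSet_iff_forall.1 h0) x hx
  -- Near every point the extension by zero agrees with ω or with 0, so it is globally C¹ and
  -- `integral_extDeriv_eq_zero` applies.
  have hcases : ∀ x, T.indicator ω =ᶠ[𝓝 x] ω ∧ x ∈ T ∨ T.indicator ω =ᶠ[𝓝 x] 0 ∧ x ∉ T := by
    intro x
    by_cases hx : x ∈ T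
    · left
      refine ⟨?_, hx⟩
      by_cases hi : x ∈ interior T
      · filter_upwards [isOpen_interior.mem_nhds hi] with y hy
        exact indicator_of_mem (interior_subset hy) _
      · filter_upwards [hfr x ⟨subset_closure hx, hi⟩] with y hy
        simp only [Pi.zero_apply] at hy
        simp [indicator, hy]
    · right
      refine ⟨?_, hx⟩
      filter_upwards [hT.isClosed.isOpen_compl.mem_nhds hx] with y hy
      exact indicator_of_notMem hy _
  have hd : ContDiff ℝ 1 (T.indicator ω) := by
    rw [contDiff_iff_contDiffAt]
    intro x
    rcases hcases x with ⟨h, -⟩ | ⟨h, -⟩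
    · exact hω.contDiffAt.congr_of_eventuallyEq h
    · exact (contDiffAt_const (c := (0 : Alt (Space m) m))).congr_of_eventuallyEq h
  have hc : HasCompactSupport (T.indicator ω) :=
    HasCompactSupport.intro hT fun x hx => indicator_of_notMem hx _
  rw [← integral_extDeriv_eq_zero hd hc, ← integral_indicator hT.measurableSet]
  refine integral_congr_ae (.of_forall fun x => ?_)
  rcases hcases x with ⟨h, hx⟩ | ⟨h, hx⟩
  · simp [indicator, hx, h.extDeriv_eq]
  · simp [indicator, hx, extDeriv_eq_zero_of_eventuallyEq h]

/-- The integral of an `m`-form over the boundary of `T`, weighted by the function `f`. -/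
def LipschitzAtlas.bdIntegral (A : LipschitzAtlas T) (f : Space m → ℝ) (ω : FormField m m) : ℝ :=
  ∑ j, (A.chart j).orient * ∫ y, f ((A.chart j).param y) * (A.cutoff j ((A.chart j).param y) *
    ω ((A.chart j).param y) (fun e => fderiv ℝ (A.chart j).param y (Pi.single e 1)))

/-- Stokes' theorem on a compact set with Lipschitz boundary. -/
theorem LipschitzAtlas.integral_extDeriv (A : LipschitzAtlas T) (hT : IsCompact T)
    {ω : FormField m m} (hω : ContDiff ℝ 1 ω) :
    ∫ x in T, extDeriv ω x (stdVec m) = A.bdIntegral 1 ω := by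
  set ψ : Fin A.N → FormField m m := fun j x => A.cutoff j x • ω x with hψ
  have hψd : ∀ j, ContDiff ℝ 1 (ψ j) := fun j =>
    ((A.smooth j).of_le (by exact_mod_cast le_top)).smul hω
  have hψc : ∀ j, HasCompactSupport (ψ j) := fun j => (A.compact_supp j).smul_right
  have hψs : ∀ j, tsupport (ψ j) ⊆ (A.chart j).U := fun j =>
    (tsupport_smul_subset_left _ _).trans (A.supp_subset j)
  -- The cutoffs sum to 1 only near the frontier; the remainder vanishes there and contributes
  -- nothing.
  set R : FormField m m := fun x => ω x - ∑ j, ψ j x with hR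
  have hsumd : ContDiff ℝ 1 fun x => ∑ j, ψ j x := ContDiff.sum fun j _ => hψd j
  have hRd : ContDiff ℝ 1 R := hω.sub hsumd
  have hR0 : ∀ᶠ x in 𝓝ˢ (frontier T), R x = 0 := by
    filter_upwards [A.sum_eq_one] with x hx
    simp only [hR, hψ]
    rw [← Finset.sum_smul, hx, one_smul, sub_self]
  have hsum : ∀ x, extDeriv ω x (stdVec m) =
      ∑ j, extDeriv (ψ j) x (stdVec m) + extDeriv R x (stdVec m) := by
    intro x
    have hf : fderiv ℝ ω x = ∑ j, fderiv ℝ (ψ j) x + fderiv ℝ R x := by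
      have h1 := (HasFDerivAt.fun_sum fun j (_ : j ∈ Finset.univ) =>
        ((hψd j).differentiable (by simp) x).hasFDerivAt).add
        (hRd.differentiable (by simp) x).hasFDerivAt
      rw [← h1.fderiv]
      congr 1
      ext y : 1
      simp [hR]
    simp only [extDeriv, ← ContinuousAlternatingMap.alternatizeUncurryFinCLM_apply]
    rw [hf, map_add, map_sum, ContinuousAlternatingMap.add_apply,
      ContinuousAlternatingMap.sum_apply]
  have hcont : ∀ φ : FormField m m, ContDiff ℝ 1 φ →
      Continuous fun x => extDeriv φ x (stdVec m) := fun φ hφ =>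
    (ContinuousAlternatingMap.apply ℝ (Space m) ℝ (stdVec m)).continuous.comp
      ((ContinuousAlternatingMap.alternatizeUncurryFinCLM ℝ (Space m) ℝ).continuous.comp
        (hφ.continuous_fderiv (by simp)))
  have hint : ∀ φ : FormField m m, ContDiff ℝ 1 φ →
      IntegrableOn (fun x => extDeriv φ x (stdVec m)) T := fun φ hφ =>
    (hcont φ hφ).continuousOn.integrableOn_compact hT
  simp only [hsum]
  rw [integral_add (integrable_finsetSum _ fun j _ => hint _ (hψd j)) (hint R hRd),
    integral_finsetSum _ fun j _ => hint _ (hψd j), setIntegral_extDeriv_eq_zero hT hRd hR0,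
    add_zero, bdIntegral]
  refine Finset.sum_congr rfl fun j _ => ?_
  rw [(A.chart j).integral_extDeriv hT.measurableSet (hψd j) (hψc j) (hψs j)]
  simp [hψ]

end

end PortHam

open MeasureTheory Set Filter Topology

namespace PortHam

noncomputable section

/-! ### Weak exterior derivatives of piecewise smooth forms -/

/-- Provides finite bases of constant test covectors and compactness of closed balls of covectors.
-/
instance finiteDimensional_alt (m k : ℕ) : FiniteDimensional ℝ (Alt (Space m) k) :=
  FiniteDimensional.of_injective
    (ContinuousMultilinearMap.toMultilinearMapLinear.comp
      (ContinuousAlternatingMap.toContinuousMultilinearMapLinear (R := ℝ) (A := ℝ)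
        (M := Space m) (N := ℝ) (ι := Fin k)))
    (fun a b hab => by
      ext v
      exact congrArg (fun F => F v) hab)

variable {m k l N : ℕ} {T : Set (Space m)}

lemma continuous_wedgeEval {Z : Type*} [TopologicalSpace Z] {X : Type} [NormedAddCommGroup X]
    [NormedSpace ℝ X] (h : k + l = N) {a : Z → Alt X k} {b : Z → Alt X l}
    (ha : Continuous a) (hb : Continuous b) (v : Fin N → X) :
    Continuous fun x => wedgeEval h (a x) (b x) v := by
  simp only [← wedge_apply]
  exact (ContinuousAlternatingMap.apply ℝ X ℝ v).continuous.comp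
    (((wedge h).continuous.comp ha).clm_apply hb)

lemma contDiff_wedge {n : WithTop ℕ∞} (h : k + l = N) {a : FormField m k} {b : FormField m l}
    (ha : ContDiff ℝ n a) (hb : ContDiff ℝ n b) :
    ContDiff ℝ n fun x => wedge h (a x) (b x) := by
  have h0 := ContinuousLinearMap.contDiff (𝕜 := ℝ) (E := Alt (Space m) k)
    (F := Alt (Space m) l →L[ℝ] Alt (Space m) N) (n := n) (wedge h)
  have h1 := ContDiff.comp (𝕜 := ℝ) (E := Space m) (F := Alt (Space m) k)
    (G := Alt (Space m) l →L[ℝ] Alt (Space m) N) h0 ha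
  exact ContDiff.clm_apply (𝕜 := ℝ) (E := Space m) (F := Alt (Space m) l)
    (G := Alt (Space m) N) h1 hb

lemma continuous_extDeriv {ω : FormField m k} (hω : ContDiff ℝ 1 ω) : Continuous (extDeriv ω) :=
  (ContinuousAlternatingMap.alternatizeUncurryFinCLM ℝ (Space m) ℝ).continuous.comp
    (hω.continuous_fderiv (by simp))

lemma wedgeEval_zero_right {X : Type} [NormedAddCommGroup X] [NormedSpace ℝ X] (h : k + l = N)
    (a : Alt X k) (v : Fin N → X) : wedgeEval h a 0 v = 0 := by
  simp [wedgeEval]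

lemma wedgeEval_sub_left {X : Type} [NormedAddCommGroup X] [NormedSpace ℝ X] (h : k + l = N)
    (a a' : Alt X k) (b : Alt X l) (v : Fin N → X) :
    wedgeEval h (a - a') b v = wedgeEval h a b v - wedgeEval h a' b v := by
  simp [← wedge_apply]

lemma extDeriv_eq_zero_of_notMem_tsupport {ω : FormField m k} {x : Space m}
    (hx : x ∉ tsupport ω) : extDeriv ω x = 0 :=
  extDeriv_eq_zero_of_eventuallyEq (notMem_tsupport_iff_eventuallyEq.1 hx)

/-! ### Frontiers of Lipschitz sets -/

lemma volume_graph_eq_zero {h : (Fin m → ℝ) → ℝ} (hh : Continuous h) :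
    volume {p : ℝ × (Fin m → ℝ) | p.1 = h p.2} = 0 := by
  have hm : MeasurableSet {p : ℝ × (Fin m → ℝ) | p.1 = h p.2} :=
    (isClosed_eq continuous_fst (hh.comp continuous_snd)).measurableSet
  rw [Measure.volume_eq_prod, Measure.prod_apply_symm hm]
  simp

/-- The graph point lies in `T`, and raising the first coordinate slightly leaves `T`. -/
lemma LipschitzChart.param_mem_frontier (c : LipschitzChart T) {y : Fin m → ℝ}
    (hy : c.param y ∈ c.U) : c.param y ∈ frontier T := by
  refine ⟨subset_closure ?_, fun hi => ?_⟩
  · rw [c.param_eq_coord] at hy ⊢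
    exact (c.coord_mem_iff _ hy).2 le_rfl
  · have hev : ∀ᶠ x in 𝓝 (c.param y), x ∈ T ∧ x ∈ c.U :=
      Filter.Eventually.and (mem_interior_iff_mem_nhds.1 hi) (c.isOpen_U.mem_nhds hy)
    have ht : Tendsto (fun s : ℝ => c.coord (s, y)) (𝓝 (c.height y)) (𝓝 (c.param y)) :=
      (c.coord.continuous.comp (by fun_prop : Continuous fun s : ℝ => (s, y))).tendsto _
    have h1 : ∀ᶠ s in 𝓝 (c.height y), s ≤ c.height y := by
      filter_upwards [ht.eventually hev] with s hs
      exact (c.coord_mem_iff (s, y) hs.2).1 hs.1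
    obtain ⟨ε, hε, hball⟩ := Metric.eventually_nhds_iff.1 h1
    have := hball (y := c.height y + ε / 2) (by simp [abs_of_pos hε]; linarith)
    linarith

/-- Off the graph the strict inequality persists nearby, so the point is interior to `T` or to its
complement. -/
lemma LipschitzChart.frontier_inter_subset (c : LipschitzChart T) :
    frontier T ∩ c.U ⊆ c.coord '' {p | p.1 = c.height p.2} := by
  rintro x ⟨hx, hU⟩
  obtain ⟨p, rfl⟩ := c.coord.surjective x
  refine ⟨p, ?_, rfl⟩
  have hopen : ∀ᶠ q in 𝓝 p, c.coord q ∈ c.U :=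
    c.coord.continuous.continuousAt.eventually (c.isOpen_U.mem_nhds hU)
  have hmap : 𝓝 (c.coord p) = map c.coord (𝓝 p) := (c.coord.toHomeomorph.map_nhds_eq p).symm
  rcases lt_trichotomy p.1 (c.height p.2) with h | h | h
  · exfalso
    apply hx.2
    have h1 : ∀ᶠ q : ℝ × (Fin m → ℝ) in 𝓝 p, q.1 < c.height q.2 :=
      (isOpen_lt continuous_fst (c.height_continuous.comp continuous_snd)).mem_nhds h
    have h2 : ∀ᶠ q in 𝓝 p, c.coord q ∈ T := by
      filter_upwards [hopen, h1] with q hq hlt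
      exact (c.coord_mem_iff q hq).2 hlt.le
    rw [mem_interior_iff_mem_nhds, hmap]
    exact h2
  · exact h
  · exfalso
    have h1 : ∀ᶠ q : ℝ × (Fin m → ℝ) in 𝓝 p, c.height q.2 < q.1 :=
      (isOpen_lt (c.height_continuous.comp continuous_snd) continuous_fst).mem_nhds h
    have h2 : ∀ᶠ q in 𝓝 p, c.coord q ∉ T := by
      filter_upwards [hopen, h1] with q hq hlt
      exact fun hT => absurd ((c.coord_mem_iff q hq).1 hT) (not_le.2 hlt)
    have h3 : ∀ᶠ x in 𝓝 (c.coord p), x ∉ T := by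
      rw [hmap]
      exact h2
    exact (mem_closure_iff_frequently.1 hx.1) h3

/-- Since the cutoffs sum to 1 on the frontier, each frontier point lies in a chart; the chart
coordinates preserve volume and graphs are null. -/
lemma LipschitzAtlas.volume_frontier (A : LipschitzAtlas T) : volume (frontier T) = 0 := by
  have hsub : frontier T ⊆ ⋃ j, (A.chart j).coord '' {p | p.1 = (A.chart j).height p.2} := by
    intro x hx
    have h1 : ∑ j, A.cutoff j x = 1 :=
      (eventually_nhdsSet_iff_forall.1 A.sum_eq_one x hx).self_of_nhds
    obtain ⟨j, -, hj⟩ := Finset.exists_ne_zero_of_sum_ne_zero (h1.trans_ne one_ne_zero)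
    exact mem_iUnion.2 ⟨j, (A.chart j).frontier_inter_subset
      ⟨hx, A.supp_subset j (subset_tsupport _ hj)⟩⟩
  refine measure_mono_null hsub (measure_iUnion_null fun j => ?_)
  have hemb := (A.chart j).coord.toHomeomorph.measurableEmbedding
  have := (A.chart j).coord_measurePreserving.measure_preimage_emb hemb
    ((A.chart j).coord '' {p | p.1 = (A.chart j).height p.2})
  rw [← this, preimage_image_eq _ (A.chart j).coord.injective]
  exact volume_graph_eq_zero (A.chart j).height_continuous

variable {M : Set (Space m)} {ι : Type} [Fintype ι]

namespace Mesh

variable (𝓣 : Mesh M ι)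

/-- `a'` is a family of globally defined `C¹` forms which extends the broken form `a`. -/
structure IsExtension (a a' : BrokenForm m ι k) : Prop where
  contDiff : ∀ i, ContDiff ℝ 1 (a' i)
  eqOn : ∀ i, EqOn (a i) (a' i) (𝓣.cell i)

lemma interior_cell_subset (i : ι) : interior (𝓣.cell i) ⊆ interior M :=
  interior_mono ((subset_iUnion 𝓣.cell i).trans 𝓣.iUnion_cell.subset)

lemma isCompact (𝓣 : Mesh M ι) : IsCompact M := 𝓣.iUnion_cell ▸ isCompact_iUnion 𝓣.isCompact_cell

lemma glue_apply (a : BrokenForm m ι k) {i : ι} {x : Space m} (hx : x ∈ interior (𝓣.cell i)) :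
    𝓣.glue a x = a i x := by
  rw [glue, Finset.sum_eq_single i]
  · exact indicator_of_mem hx _
  · intro j _ hj
    exact indicator_of_notMem (fun hjx => disjoint_left.1 (𝓣.disjoint_interior hj) hjx hx) _
  · simp

lemma interior_ae_eq_cell (i : ι) : (interior (𝓣.cell i) : Set (Space m)) =ᵐ[volume] 𝓣.cell i :=
  interior_ae_eq_of_null_frontier (𝓣.atlas i).volume_frontier

lemma interior_ae_eq_iUnion :
    (interior M : Set (Space m)) =ᵐ[volume] ⋃ i, interior (𝓣.cell i) := by
  refine LE.le.eventuallyLE ?_ |>.antisymm ?_ |>.symm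
  · exact iUnion_subset 𝓣.interior_cell_subset
  · have h1 : (⋃ i, interior (𝓣.cell i) : Set (Space m)) =ᵐ[volume] ⋃ i, 𝓣.cell i :=
      Filter.EventuallyEq.countable_iUnion 𝓣.interior_ae_eq_cell
    rw [𝓣.iUnion_cell] at h1
    exact (LE.le.eventuallyLE interior_subset).trans h1.symm.le

/-- Cell boundaries are null, so only open cells count. `F` will come from the glued form or its
weak derivative, `G i` from the smooth extensions. -/
lemma setIntegral_interior {F : Space m → ℝ} {G : ι → Space m → ℝ}
    (hFG : ∀ i, ∀ᵐ x, x ∈ interior (𝓣.cell i) → F x = G i x)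
    (hG : ∀ i, IntegrableOn (G i) (𝓣.cell i)) :
    ∫ x in interior M, F x = ∑ i, ∫ x in 𝓣.cell i, G i x := by
  have hF : ∀ i, IntegrableOn F (interior (𝓣.cell i)) := fun i =>
    ((hG i).mono_set interior_subset).congr
      (((ae_restrict_iff' isOpen_interior.measurableSet).2 (hFG i)).mono fun x hx => hx.symm)
  rw [setIntegral_congr_set 𝓣.interior_ae_eq_iUnion, integral_iUnion_fintype
    (fun i => isOpen_interior.measurableSet) 𝓣.disjoint_interior hF]
  refine Finset.sum_congr rfl fun i _ => ?_
  rw [← setIntegral_congr_set (𝓣.interior_ae_eq_cell i)]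
  exact setIntegral_congr_ae isOpen_interior.measurableSet (hFG i)

variable {𝓣}

/-- In the interior of a cell, the weak exterior derivative is the classical one. -/
lemma IsExtension.ae_eq_extDeriv {a a' : BrokenForm m ι k} (ha : 𝓣.IsExtension a a')
    {η : FormField m (k + 1)} (hη : MemLp η 2 (volume.restrict (interior M)))
    (hw : IsWeakExtDeriv (interior M) (𝓣.glue a) η) (h : k + 1 + l = m + 1) (i : ι) :
    ∀ᵐ x, x ∈ interior (𝓣.cell i) → ∀ c : Alt (Space m) l,
      wedgeEval h (η x) c (stdVec m) = wedgeEval h (extDeriv (a' i) x) c (stdVec m) := by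
  have hkl : k + l = m := by omega
  set U := interior (𝓣.cell i) with hU
  have hUo : IsOpen U := isOpen_interior
  have hUM : U ⊆ interior M := 𝓣.interior_cell_subset i
  have hfin : volume (interior M) ≠ ⊤ :=
    (measure_mono interior_subset |>.trans_lt 𝓣.isCompact.measure_lt_top).ne
  have : IsFiniteMeasure (volume.restrict (interior M)) := ⟨by simpa using hfin.lt_top⟩
  have hηint : IntegrableOn η (interior M) := hη.integrable (by norm_num)
  -- For fixed `c`, testing with g • c for all smooth `g` supported in the open cell reduces the
  -- claim to the fundamental lemma of the calculus of variations.
  have key : ∀ c : Alt (Space m) l, ∀ᵐ x, x ∈ U →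
      wedgeEval h (η x - extDeriv (a' i) x) c (stdVec m) = 0 := by
    intro c
    have hpair : ∀ A : Alt (Space m) (k + 1), wedgeEval h A c (stdVec m) =
        ((ContinuousAlternatingMap.apply ℝ (Space m) ℝ (stdVec m)).comp ((wedge h).flip c)) A :=
      fun A => (wedge_apply h A c _).symm
    have hi1 : IntegrableOn (fun x => wedgeEval h (η x) c (stdVec m)) U := by
      simp only [hpair]
      exact ContinuousLinearMap.integrable_comp _ (hηint.mono_set hUM)
    have hi2 : IntegrableOn (fun x => wedgeEval h (extDeriv (a' i) x) c (stdVec m)) U :=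
      ((continuous_wedgeEval h (continuous_extDeriv (ha.contDiff i)) continuous_const
        _).continuousOn.integrableOn_compact (𝓣.isCompact_cell i)).mono_set interior_subset
    refine hUo.ae_eq_zero_of_integral_contDiff_smul_eq_zero ?_ fun g hg hgc hgU => ?_
    · simp only [wedgeEval_sub_left]
      exact (hi1.sub hi2).locallyIntegrableOn
    · set φ : FormField m l := fun x => g x • c with hφ
      have hφd : ContDiff ℝ (⊤ : ℕ∞) φ := hg.smul contDiff_const
      have hφ1 : ContDiff ℝ 1 φ := hφd.of_le (by exact_mod_cast le_top)
      have hφc : HasCompactSupport φ := hgc.smul_right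
      have hφU : tsupport φ ⊆ U := (tsupport_smul_subset_left _ _).trans hgU
      have hφ0 : ∀ x, x ∉ U → φ x = 0 := fun x hx =>
        image_eq_zero_of_notMem_tsupport fun hm => hx (hφU hm)
      have hdφ0 : ∀ x, x ∉ U → extDeriv φ x = 0 := fun x hx =>
        extDeriv_eq_zero_of_notMem_tsupport fun hm => hx (hφU hm)
      have E1 := hw l h φ hφd hφc (hφU.trans hUM)
      have S1 : ∀ F : Space m → ℝ, (∀ x, x ∉ U → F x = 0) →
          ∫ x in interior M, F x = ∫ x in U, F x := fun F hF =>
        setIntegral_eq_of_subset_of_forall_sdiff_eq_zero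
          (isOpen_interior (s := M)).measurableSet hUM fun x hx => hF x hx.2
      have S2 : ∀ F : Space m → ℝ, (∀ x, x ∉ U → F x = 0) → ∫ x, F x = ∫ x in U, F x :=
        fun F hF => (setIntegral_eq_integral_of_forall_compl_eq_zero hF).symm
      rw [S1 (fun x => wedgeEval h (η x) (φ x) (stdVec m))
          fun x hx => by rw [hφ0 x hx, wedgeEval_zero_right],
        S1 (fun x => wedgeEval (by omega : k + (l + 1) = m + 1) (𝓣.glue a x)
          (extDeriv φ x) (stdVec m)) fun x hx => by rw [hdφ0 x hx, wedgeEval_zero_right]] at E1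
      have E1' : ∫ x in U, wedgeEval (by omega : k + (l + 1) = m + 1) (𝓣.glue a x)
          (extDeriv φ x) (stdVec m) = ∫ x in U, wedgeEval (by omega : k + (l + 1) = m + 1)
          (a' i x) (extDeriv φ x) (stdVec m) := by
        refine setIntegral_congr_fun hUo.measurableSet fun x hx => ?_
        rw [𝓣.glue_apply a hx, ha.eqOn i (interior_subset hx)]
      -- The classical counterpart of the weak identity, from ∫ d(a' ∧ φ) = 0.
      have E2 := integral_extDeriv_eq_zero (ω := fun x => wedge hkl (a' i x) (φ x))
        (contDiff_wedge hkl (ha.contDiff i) hφ1)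
        (hφc.mono fun x hx hx0 => hx (by simp [hx0]))
      have hj1 : IntegrableOn (fun x => wedgeEval h (extDeriv (a' i) x) (φ x) (stdVec m)) U :=
        ((continuous_wedgeEval h (continuous_extDeriv (ha.contDiff i)) hφ1.continuous
          _).continuousOn.integrableOn_compact (𝓣.isCompact_cell i)).mono_set interior_subset
      have hj2 : IntegrableOn (fun x => wedgeEval (by omega : k + (l + 1) = m + 1) (a' i x)
          (extDeriv φ x) (stdVec m)) U :=
        ((continuous_wedgeEval _ (ha.contDiff i).continuous (continuous_extDeriv hφ1)
          _).continuousOn.integrableOn_compact (𝓣.isCompact_cell i)).mono_set interior_subset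
      have hL : ∀ x, extDeriv (fun x => wedge hkl (a' i x) (φ x)) x (stdVec m) =
          wedgeEval h (extDeriv (a' i) x) (φ x) (stdVec m) +
            (-1) ^ k * wedgeEval (by omega : k + (l + 1) = m + 1) (a' i x) (extDeriv φ x)
              (stdVec m) := fun x =>
        extDeriv_wedge hkl ((ha.contDiff i).differentiable (by simp) x)
          (hφ1.differentiable (by simp) x) _
      simp only [hL] at E2
      rw [S2 _ fun x hx => by
        rw [hφ0 x hx, hdφ0 x hx, wedgeEval_zero_right, wedgeEval_zero_right]; simp,
        integral_add hj1 (hj2.const_mul _), integral_const_mul] at E2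
      have hg0 : ∀ x, x ∉ U → g x = 0 := fun x hx =>
        image_eq_zero_of_notMem_tsupport fun hm => hx (hgU hm)
      rw [S2 _ fun x hx => by rw [hg0 x hx, zero_smul]]
      have hsm : ∀ x, g x • wedgeEval h (η x - extDeriv (a' i) x) c (stdVec m) =
          wedgeEval h (η x) (φ x) (stdVec m) -
            wedgeEval h (extDeriv (a' i) x) (φ x) (stdVec m) := by
        intro x
        rw [wedgeEval_sub_left, hφ]
        simp only [wedgeEval_smul_right, smul_eq_mul]
        ring
      have hj3 : IntegrableOn (fun x => wedgeEval h (η x) (φ x) (stdVec m)) U := by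
        obtain ⟨C, hC⟩ := hgc.exists_bound_of_continuous hg.continuous
        simp only [hφ, wedgeEval_smul_right]
        exact hi1.bdd_mul (c := C) hg.continuous.aestronglyMeasurable (.of_forall hC)
      simp only [hsm]
      rw [integral_sub hj3 hj1, E1, E1']
      rw [pow_succ]
      linarith
  -- A finite basis makes the exceptional null set independent of `c`.
  set B := Module.finBasis ℝ (Alt (Space m) l)
  have hall : ∀ᵐ x, ∀ j, x ∈ U → wedgeEval h (η x - extDeriv (a' i) x) (B j) (stdVec m) = 0 :=
    ae_all_iff.2 fun j => key (B j)
  filter_upwards [hall] with x hx hxU c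
  rw [← sub_eq_zero, ← wedgeEval_sub_left, ← B.sum_repr c, ← wedge_apply, map_sum,
    ContinuousAlternatingMap.sum_apply]
  refine Finset.sum_eq_zero fun j _ => ?_
  rw [map_smul, ContinuousAlternatingMap.smul_apply, wedge_apply, hx j hxU, smul_zero]

/-- Integration by parts of a conforming piecewise smooth form against a smooth test form. -/
lemma IsExtension.sum_integral_extDeriv_wedge {a a' : BrokenForm m ι k}
    (ha : 𝓣.IsExtension a a') (hH : MemHForm (interior M) (𝓣.glue a)) (h : k + 1 + l = m + 1)
    {φ : FormField m l} (hφ : ContDiff ℝ (⊤ : ℕ∞) φ) (hc : HasCompactSupport φ)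
    (hs : tsupport φ ⊆ interior M) :
    ∑ i, ∫ x in 𝓣.cell i, wedgeEval h (extDeriv (a' i) x) (φ x) (stdVec m) =
      (-1) ^ (k + 1) * ∑ i, ∫ x in 𝓣.cell i,
        wedgeEval (by omega : k + (l + 1) = m + 1) (a' i x) (extDeriv φ x) (stdVec m) := by
  obtain ⟨-, η, hη, hw⟩ := hH
  have hφ1 : ContDiff ℝ 1 φ := hφ.of_le (by exact_mod_cast le_top)
  have E := hw l h φ hφ hc hs
  rw [𝓣.setIntegral_interior (G := fun i x => wedgeEval h (extDeriv (a' i) x) (φ x) (stdVec m)),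
    𝓣.setIntegral_interior (G := fun i x => wedgeEval (by omega : k + (l + 1) = m + 1) (a' i x)
      (extDeriv φ x) (stdVec m))] at E
  · exact E
  · refine fun i => .of_forall fun x hx => ?_
    rw [𝓣.glue_apply a hx, ha.eqOn i (interior_subset hx)]
  · exact fun i => (continuous_wedgeEval _ (ha.contDiff i).continuous (continuous_extDeriv hφ1)
      _).continuousOn.integrableOn_compact (𝓣.isCompact_cell i)
  · intro i
    filter_upwards [ha.ae_eq_extDeriv hη hw h i] with x hx hxi
    exact hx hxi _
  · exact fun i => (continuous_wedgeEval h (continuous_extDeriv (ha.contDiff i)) hφ1.continuous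
      _).continuousOn.integrableOn_compact (𝓣.isCompact_cell i)

end Mesh

end

end PortHam

open MeasureTheory Set Filter Topology
open scoped Convolution

namespace PortHam

noncomputable section

/-! ### Integration by parts for conforming forms -/

variable {m k l N : ℕ}

/-- Both sides expand into the same terms; the sign collects moving the covector `A` past `c` and
past `w` and exchanging `c` with `w`. It transfers dρ from the mollified form to the test form. -/
lemma wedgeEval_alternatize_smulRight {X : Type} [NormedAddCommGroup X] [NormedSpace ℝ X]
    (h : k + (l + 1) = N + 1) (h' : l + (k + 1) = N + 1) (A : X →L[ℝ] ℝ) (c : Alt X k)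
    (w : Alt X l) (v : Fin (N + 1) → X) :
    wedgeEval h c (ContinuousAlternatingMap.alternatizeUncurryFin (A.smulRight w)) v =
      (-1) ^ (k + l + k * l) *
        wedgeEval h' w (ContinuousAlternatingMap.alternatizeUncurryFin (A.smulRight c)) v := by
  rw [wedgeEval_alternatize_right, wedgeEval_alternatize_right]
  simp only [ContinuousLinearMap.smulRight_apply, wedgeEval_smul_right,
    wedgeEval_comm (by omega : l + k = N) w c]
  rw [Finset.mul_sum, Finset.mul_sum, Finset.mul_sum]
  refine Finset.sum_congr rfl fun i _ => ?_
  have h1 : ((-1 : ℝ) ^ (k * l)) * (-1) ^ (l * k) = 1 := by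
    rw [mul_comm l k, ← mul_pow]; simp
  have h2 : ((-1 : ℝ) ^ l) * (-1) ^ l = 1 := by rw [← mul_pow]; simp
  rw [pow_add, pow_add]
  linear_combination (-((-1) ^ k * ((-1) ^ (i : ℕ) * (A (v i) *
    wedgeEval (by omega : k + l = N) c w (i.removeNth v)))) * (-1) ^ l * (-1) ^ l) * h1 -
    ((-1) ^ k * ((-1) ^ (i : ℕ) * (A (v i) *
    wedgeEval (by omega : k + l = N) c w (i.removeNth v)))) * h2

lemma extDeriv_smul_form {f : Space m → ℝ} {ω : FormField m k} {x : Space m}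
    (hf : DifferentiableAt ℝ f x) (hω : DifferentiableAt ℝ ω x) :
    extDeriv (fun y => f y • ω y) x =
      f x • extDeriv ω x +
        ContinuousAlternatingMap.alternatizeUncurryFin ((fderiv ℝ f x).smulRight (ω x)) := by
  rw [extDeriv, (hf.hasFDerivAt.fun_smul hω.hasFDerivAt).fderiv,
    ContinuousAlternatingMap.alternatizeUncurryFin_add,
    ContinuousAlternatingMap.alternatizeUncurryFin_smul, extDeriv]

lemma extDeriv_smul_const {f : Space m → ℝ} (c : Alt (Space m) k) {x : Space m}
    (hf : DifferentiableAt ℝ f x) :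
    extDeriv (fun y => f y • c) x =
        ContinuousAlternatingMap.alternatizeUncurryFin ((fderiv ℝ f x).smulRight c) := by
  rw [extDeriv, (hf.hasFDerivAt.smul_const c).fderiv]

lemma hasFDerivAt_const_sub_comp {E : Type*} [NormedAddCommGroup E] [NormedSpace ℝ E]
    {ρ : E → ℝ} (hρ : Differentiable ℝ ρ) (x y : E) :
    HasFDerivAt (fun y => ρ (x - y)) (-(fderiv ℝ ρ (x - y))) y := by
  have := HasFDerivAt.comp (g := ρ) (f := fun y : E => x - y) y
    (hρ (x - y)).hasFDerivAt ((hasFDerivAt_id y).const_sub x)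
  simpa [Function.comp_def] using this

/-- The derivative falls on the kernel alone, so `g` may jump across cell interfaces. -/
lemma hasFDerivAt_convolution_lsmul {V : Type*} [NormedAddCommGroup V] [NormedSpace ℝ V]
    {ρ : Space m → ℝ} (hρ : ContDiff ℝ 1 ρ) (hc : HasCompactSupport ρ) {g : Space m → V}
    (hg : LocallyIntegrable g) (x : Space m) :
    HasFDerivAt (ρ ⋆[ContinuousLinearMap.lsmul ℝ ℝ, volume] g)
      (∫ y, ContinuousLinearMap.smulRightL ℝ (Space m) V (fderiv ℝ ρ (x - y)) (g y)) x := by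
  have h1 := hc.hasFDerivAt_convolution_left (ContinuousLinearMap.lsmul ℝ ℝ) hρ hg x
  rw [convolution_eq_swap] at h1
  have e : ∀ y, ContinuousLinearMap.precompL (Space m) (ContinuousLinearMap.lsmul ℝ ℝ)
      (fderiv ℝ ρ (x - y)) (g y) =
        ContinuousLinearMap.smulRightL ℝ (Space m) V (fderiv ℝ ρ (x - y)) (g y) := by
    intro y
    ext v
    simp
  simp only [e] at h1
  exact h1

lemma integrable_sum_indicator {E ι : Type*} [Fintype ι] [NormedAddCommGroup E]
    {U : ι → Set (Space m)} (hU : ∀ i, IsOpen (U i)) {f : ι → Space m → E}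
    (hf : ∀ i, IntegrableOn (f i) (U i)) : Integrable fun x => ∑ i, (U i).indicator (f i) x :=
  integrable_finsetSum Finset.univ fun i _ => (hf i).integrable_indicator (hU i).measurableSet

lemma integrable_clm_apply {V E : Type*} [NormedAddCommGroup V] [NormedSpace ℝ V]
    [NormedAddCommGroup E] [NormedSpace ℝ E] {F : Space m → V →L[ℝ] E} (hF : Continuous F)
    (hc : HasCompactSupport F) {g : Space m → V} (hg : Integrable g) :
    Integrable fun y => F y (g y) := by
  obtain ⟨C, hC⟩ := hc.exists_bound_of_continuous hF
  exact (ContinuousLinearMap.id ℝ (V →L[ℝ] E)).integrable_of_bilin_of_bdd_left C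
    hF.aestronglyMeasurable (.of_forall hC) hg

variable {M : Set (Space m)} {ι : Type} [Fintype ι]

namespace Mesh

variable (𝓣 : Mesh M ι)

lemma glue_of_notMem (B : BrokenForm m ι k) {x : Space m} (hx : x ∉ interior M) :
    𝓣.glue B x = 0 :=
  Finset.sum_eq_zero fun i _ => indicator_of_notMem (fun h => hx (𝓣.interior_cell_subset i h)) _

lemma integrable_glue {B : BrokenForm m ι k} (hB : ∀ i, Continuous (B i)) :
    Integrable (𝓣.glue B) := by
  have h1 : ∀ i, IntegrableOn (B i) (interior (𝓣.cell i)) := fun i =>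
    ((hB i).continuousOn.integrableOn_compact (𝓣.isCompact_cell i)).mono_set interior_subset
  exact integrable_sum_indicator (E := Alt (Space m) k) (fun i => isOpen_interior) h1

lemma exists_bound_glue {B : BrokenForm m ι k} (hB : ∀ i, Continuous (B i)) :
    ∃ C, ∀ x, ‖𝓣.glue B x‖ ≤ C := by
  choose C hC using fun i =>
    (𝓣.isCompact_cell i).exists_bound_of_continuousOn (hB i).continuousOn
  refine ⟨∑ i, |C i|, fun x => norm_sum_le_of_le _ fun i _ => ?_⟩
  by_cases hx : x ∈ interior (𝓣.cell i)
  · rw [indicator_of_mem hx]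
    exact (hC i x (interior_subset hx)).trans (le_abs_self _)
  · rw [indicator_of_notMem hx]
    simp

/-- Mollification of the form defined by a broken form. -/
def mollify (ρ : Space m → ℝ) (B : BrokenForm m ι k) : FormField m k :=
  ρ ⋆[ContinuousLinearMap.lsmul ℝ ℝ, volume] 𝓣.glue B

variable {𝓣}

lemma contDiff_mollify {n : ℕ∞} {ρ : Space m → ℝ} (hρ : ContDiff ℝ n ρ)
    (hc : HasCompactSupport ρ) {B : BrokenForm m ι k} (hB : ∀ i, Continuous (B i)) :
    ContDiff ℝ n (𝓣.mollify ρ B) :=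
  hc.contDiff_convolution_left _ hρ (𝓣.integrable_glue hB).locallyIntegrable

/-- A functional turns vector-valued convolution integrals into scalar integrals over cells, the
form in which the weak identity is available. -/
lemma integral_glue_pairing {V E : Type*} [NormedAddCommGroup V] [NormedSpace ℝ V]
    [NormedAddCommGroup E] [NormedSpace ℝ E] [CompleteSpace E]
    (L : V →L[ℝ] Alt (Space m) k →L[ℝ] E) {F : Space m → V} (hF : Continuous F)
    (hFc : HasCompactSupport F) {B : BrokenForm m ι k} (hB : ∀ i, Continuous (B i))
    (Λ : E →L[ℝ] ℝ) :
    Λ (∫ y, L (F y) (𝓣.glue B y)) = ∑ i, ∫ y in 𝓣.cell i, Λ (L (F y) (B i y)) := by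
  have hLF : Continuous fun y => L (F y) := L.continuous.comp hF
  have hint : Integrable fun y => L (F y) (𝓣.glue B y) :=
    integrable_clm_apply hLF (hFc.comp_left (map_zero L)) (𝓣.integrable_glue hB)
  rw [← ContinuousLinearMap.integral_comp_comm _ hint,
    ← setIntegral_eq_integral_of_forall_compl_eq_zero (s := interior M)]
  · refine 𝓣.setIntegral_interior (fun i => .of_forall fun x hx => ?_) fun i => ?_
    · rw [𝓣.glue_apply B hx]
    · exact (Λ.continuous.comp (hLF.clm_apply (hB i))).continuousOn.integrableOn_compact
        (𝓣.isCompact_cell i)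
  · intro x hx
    rw [𝓣.glue_of_notMem B hx, map_zero, map_zero]

lemma mollify_pairing {ρ : Space m → ℝ} (hρ : Continuous ρ) (hc : HasCompactSupport ρ)
    {B : BrokenForm m ι k} (hB : ∀ i, Continuous (B i)) (Λ : Alt (Space m) k →L[ℝ] ℝ)
    (x : Space m) :
    Λ (𝓣.mollify ρ B x) = ∑ i, ∫ y in 𝓣.cell i, ρ (x - y) * Λ (B i y) := by
  rw [mollify, convolution_eq_swap]
  refine (integral_glue_pairing (𝓣 := 𝓣) (ContinuousLinearMap.lsmul ℝ ℝ)
    (F := fun y => ρ (x - y)) (hρ.comp (continuous_sub_left x))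
    (hc.comp_homeomorph (Homeomorph.subLeft x)) hB Λ).trans ?_
  simp only [ContinuousLinearMap.lsmul_apply, map_smul, smul_eq_mul]

lemma extDeriv_mollify_pairing {ρ : Space m → ℝ} (hρ : ContDiff ℝ 1 ρ) (hc : HasCompactSupport ρ)
    {B : BrokenForm m ι k} (hB : ∀ i, Continuous (B i)) (Λ : Alt (Space m) (k + 1) →L[ℝ] ℝ)
    (x : Space m) :
    Λ (extDeriv (𝓣.mollify ρ B) x) = ∑ i, ∫ y in 𝓣.cell i,
      Λ (ContinuousAlternatingMap.alternatizeUncurryFin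
        ((fderiv ℝ ρ (x - y)).smulRight (B i y))) := by
  have hfd := hasFDerivAt_convolution_lsmul hρ hc (𝓣.integrable_glue hB).locallyIntegrable x
  have he : extDeriv (𝓣.mollify ρ B) x =
      ContinuousAlternatingMap.alternatizeUncurryFinCLM ℝ (Space m) ℝ
        (∫ y, ContinuousLinearMap.smulRightL ℝ (Space m) (Alt (Space m) k)
          (fderiv ℝ ρ (x - y)) (𝓣.glue B y)) :=
    congrArg ContinuousAlternatingMap.alternatizeUncurryFin hfd.fderiv
  rw [he]
  exact integral_glue_pairing (𝓣 := 𝓣) (V := Space m →L[ℝ] ℝ)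
    (E := Space m →L[ℝ] Alt (Space m) k)
    (ContinuousLinearMap.smulRightL ℝ (Space m) (Alt (Space m) k))
    (F := fun y => fderiv ℝ ρ (x - y))
    ((hρ.continuous_fderiv (by simp)).comp (continuous_sub_left x))
    ((hc.fderiv ℝ).comp_homeomorph (Homeomorph.subLeft x)) hB
    (Λ.comp (ContinuousAlternatingMap.alternatizeUncurryFinCLM ℝ (Space m) ℝ))

/-- The exterior derivative of the mollification of a conforming form is the mollification of its
piecewise exterior derivative. -/
lemma IsExtension.wedgeEval_extDeriv_mollify {b b' : BrokenForm m ι l} (hb : 𝓣.IsExtension b b')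
    (hH : MemHForm (interior M) (𝓣.glue b)) (h : k + (l + 1) = m + 1) {ρ : Space m → ℝ}
    (hρ : ContDiff ℝ (⊤ : ℕ∞) ρ) (hc : HasCompactSupport ρ) {x : Space m}
    (hx : tsupport (fun y => ρ (x - y)) ⊆ interior M) (c : Alt (Space m) k) :
    wedgeEval h c (extDeriv (𝓣.mollify ρ b') x) (stdVec m) =
      wedgeEval h c (𝓣.mollify ρ (fun i => extDeriv (b' i)) x) (stdVec m) := by
  have h' : l + (k + 1) = m + 1 := by omega
  have hB : ∀ i, Continuous (b' i) := fun i => (hb.contDiff i).continuous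
  have hdB : ∀ i, Continuous (extDeriv (b' i)) := fun i => continuous_extDeriv (hb.contDiff i)
  have hρ1 : ContDiff ℝ 1 ρ := hρ.of_le (by exact_mod_cast le_top)
  have hsub : ContDiff ℝ (⊤ : ℕ∞) fun y : Space m => x - y := contDiff_const.sub contDiff_id
  have hφc0 : HasCompactSupport fun y => ρ (x - y) :=
    hc.comp_homeomorph (Homeomorph.subLeft x)
  set Λ : Alt (Space m) (l + 1) →L[ℝ] ℝ :=
    (ContinuousAlternatingMap.apply ℝ (Space m) ℝ (stdVec m)).comp (wedge h c) with hΛ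
  have hΛa : ∀ A, wedgeEval h c A (stdVec m) = Λ A := fun A => (wedge_apply h c A _).symm
  have hR := mollify_pairing (𝓣 := 𝓣) hρ.continuous hc hdB Λ x
  have hL := extDeriv_mollify_pairing (𝓣 := 𝓣) hρ1 hc hB Λ x
  simp only [← hΛa] at hR hL
  -- The kernel centred at `x`, times `c`, is the test form; `hx` makes it admissible.
  have hW := hb.sum_integral_extDeriv_wedge hH (l := k) (by omega : l + 1 + k = m + 1)
    (φ := fun y => ρ (x - y) • c) ((hρ.comp hsub).smul contDiff_const) hφc0.smul_right
    ((tsupport_smul_subset_left _ _).trans hx)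
  have hfφ : ∀ y, extDeriv (fun y => ρ (x - y) • c) y =
      -ContinuousAlternatingMap.alternatizeUncurryFin ((fderiv ℝ ρ (x - y)).smulRight c) := by
    intro y
    have h1 := hasFDerivAt_const_sub_comp (hρ1.differentiable (by simp)) x y
    rw [extDeriv_smul_const c h1.differentiableAt, h1.fderiv,
      ← ContinuousAlternatingMap.alternatizeUncurryFinCLM_apply,
      ← ContinuousAlternatingMap.alternatizeUncurryFinCLM_apply, ← map_neg]
    congr 1
    ext v : 1
    simp
  rw [hL, hR]
  simp only [wedgeEval_alternatize_smulRight h h', integral_const_mul, ← Finset.mul_sum]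
  simp only [hfφ] at hW
  have hneg : ∀ (A : Alt (Space m) l) (B : Alt (Space m) (k + 1)),
      wedgeEval h' A (-B) (stdVec m) = -wedgeEval h' A B (stdVec m) := by
    intro A B
    rw [← neg_one_smul ℝ B, wedgeEval_smul_right]
    ring
  simp only [hneg, integral_neg, Finset.sum_neg_distrib, wedgeEval_smul_right] at hW
  have hcm : ∀ i y, ρ (x - y) * wedgeEval h c (extDeriv (b' i) y) (stdVec m) =
      (-1) ^ (k * (l + 1)) * (ρ (x - y) * wedgeEval (by omega : l + 1 + k = m + 1)
        (extDeriv (b' i) y) c (stdVec m)) := by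
    intro i y
    rw [wedgeEval_comm h]
    ring
  simp only [hcm, integral_const_mul, ← Finset.mul_sum]
  rw [hW]
  rw [mul_add, mul_one, pow_add, pow_add, pow_add, pow_succ]
  ring

/-- The mollified value differs from the value at `x` by at most 2C, whence 3C. What matters is that
the bound does not depend on the bump. -/
lemma norm_mollify_le {B : BrokenForm m ι k} (hB : ∀ i, Continuous (B i))
    (φ : ContDiffBump (0 : Space m)) {C : ℝ} (hC : ∀ x, ‖𝓣.glue B x‖ ≤ C) (x : Space m) :
    ‖𝓣.mollify (φ.normed volume) B x‖ ≤ 3 * C := by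
  have h1 := φ.dist_normed_convolution_le (μ := volume) (x₀ := x) (ε := 2 * C)
    (𝓣.integrable_glue hB).aestronglyMeasurable fun y _ => by
      rw [dist_eq_norm]
      exact (norm_sub_le _ _).trans (by linarith [hC x, hC y])
  rw [dist_eq_norm] at h1
  have h2 := norm_add_le (𝓣.mollify (φ.normed volume) B x - 𝓣.glue B x) (𝓣.glue B x)
  rw [sub_add_cancel] at h2
  exact h2.trans (by unfold mollify; linarith [hC x])

/-- The glued form is continuous near a point of an open cell; this covers almost every point of the
cell. -/
lemma tendsto_mollify {B : BrokenForm m ι k} (hB : ∀ i, Continuous (B i))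
    {φ : ℕ → ContDiffBump (0 : Space m)} (hφ : Tendsto (fun n => (φ n).rOut) atTop (𝓝 0))
    {i : ι} {x : Space m} (hx : x ∈ interior (𝓣.cell i)) :
    Tendsto (fun n => 𝓣.mollify ((φ n).normed volume) B x) atTop (𝓝 (B i x)) := by
  refine ContDiffBump.convolution_tendsto_right (g := fun _ => 𝓣.glue B) (k := fun _ => x) hφ
    (.of_forall fun _ => (𝓣.integrable_glue hB).aestronglyMeasurable) ?_ tendsto_const_nhds
  have h1 : Tendsto (𝓣.glue B) (𝓝 x) (𝓝 (B i x)) := by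
    refine ((hB i).tendsto x).congr' ?_
    filter_upwards [isOpen_interior.mem_nhds hx] with y hy
    exact (𝓣.glue_apply B hy).symm
  exact h1.comp tendsto_snd

end Mesh

/-- Bump functions which shrink to the origin. -/
def shrinkingBump (m n : ℕ) : ContDiffBump (0 : Space m) where
  rIn := 1 / (n + 2 : ℝ)
  rOut := 1 / (n + 1 : ℝ)
  rIn_pos := by positivity
  rIn_lt_rOut := by
    apply one_div_lt_one_div_of_lt <;> first | positivity | linarith

lemma tendsto_shrinkingBump (m : ℕ) :
    Tendsto (fun n => (shrinkingBump m n).rOut) atTop (𝓝 0) :=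
  tendsto_one_div_add_atTop_nhds_zero_nat

/-- The values stay in a closed ball, compact since `E` is proper, so `P` is bounded along the
sequence and dominated convergence applies. -/
lemma tendsto_setIntegral_of_bounded {E : Type*} [NormedAddCommGroup E] [ProperSpace E]
    {K : Set (Space m)} (hK : IsCompact K) {P : Space m × E → ℝ} (hP : Continuous P)
    {f : ℕ → Space m → E} {g : Space m → E} {C : ℝ} (hf : ∀ n, Continuous (f n))
    (hC : ∀ n x, ‖f n x‖ ≤ C)
    (hlim : ∀ᵐ x, x ∈ K → Tendsto (fun n => f n x) atTop (𝓝 (g x))) :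
    Tendsto (fun n => ∫ x in K, P (x, f n x)) atTop (𝓝 (∫ x in K, P (x, g x))) := by
  obtain ⟨D, hD⟩ := (hK.prod (isCompact_closedBall (0 : E) C)).exists_bound_of_continuousOn
    hP.continuousOn
  refine tendsto_integral_of_dominated_convergence (fun _ => D)
    (fun n => (hP.comp (continuous_id.prodMk (hf n))).aestronglyMeasurable) ?_ ?_ ?_
  · exact integrableOn_const hK.measure_lt_top.ne
  · intro n
    refine (ae_restrict_iff' hK.measurableSet).2 (.of_forall fun x hx => ?_)
    exact hD _ ⟨hx, by simpa using hC n x⟩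
  · refine (ae_restrict_iff' hK.measurableSet).2 (hlim.mono fun x hx hxK => ?_)
    exact (hP.tendsto _).comp (tendsto_const_nhds.prodMk_nhds (hx hxK))

end

end PortHam

open MeasureTheory Set Filter Topology
open scoped Convolution Manifold

namespace PortHam

noncomputable section

/-! ### Cancellation of the boundary integrals in the interior -/

variable {m k l N : ℕ} {M : Set (Space m)} {ι : Type} [Fintype ι]

lemma tsupport_normed_const_sub_subset (φ : ContDiffBump (0 : Space m)) (x : Space m) :
    tsupport (fun y => φ.normed volume (x - y)) ⊆ Metric.closedBall x φ.rOut := by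
  refine closure_minimal (fun y hy => ?_) Metric.isClosed_closedBall
  have h1 : x - y ∈ tsupport (φ.normed volume) := subset_tsupport _ hy
  rw [φ.tsupport_normed_eq] at h1
  simpa [dist_eq_norm, norm_sub_rev] using h1

namespace Mesh

variable {𝓣 : Mesh M ι}

/-- Integration by parts for two conforming piecewise smooth forms, localized by a cutoff function
with support in the interior. -/
lemma IsExtension.sum_integral_extDeriv_cutoff {a a' : BrokenForm m ι k} {b b' : BrokenForm m ι l}
    (ha : 𝓣.IsExtension a a') (hb : 𝓣.IsExtension b b')
    (haH : MemHForm (interior M) (𝓣.glue a)) (hbH : MemHForm (interior M) (𝓣.glue b))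
    (h : k + l = m) {χ : Space m → ℝ} (hχ : ContDiff ℝ (⊤ : ℕ∞) χ) (hc : HasCompactSupport χ)
    (hs : tsupport χ ⊆ interior M) :
    ∑ i, ∫ x in 𝓣.cell i, extDeriv (fun y => wedge h (a' i y) (χ y • b' i y)) x (stdVec m) = 0 := by
  have h1 : k + 1 + l = m + 1 := by rw [← h, add_right_comm]
  have h2 : k + (l + 1) = m + 1 := by rw [← h, add_assoc]
  have hχ1 : ContDiff ℝ 1 χ := hχ.of_le (by exact_mod_cast le_top)
  have hB : ∀ i, Continuous (b' i) := fun i => (hb.contDiff i).continuous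
  have hdB : ∀ i, Continuous (extDeriv (b' i)) := fun i => continuous_extDeriv (hb.contDiff i)
  set alt := ContinuousAlternatingMap.alternatizeUncurryFinCLM (n := l) ℝ (Space m) ℝ with halt
  -- The Leibniz expansion of d(a' ∧ χ b), with b and db as independent arguments, so that each can
  -- be replaced by its own mollification.
  set P : ι → Space m × (Alt (Space m) l × Alt (Space m) (l + 1)) → ℝ := fun i p =>
    wedgeEval h1 (extDeriv (a' i) p.1) (χ p.1 • p.2.1) (stdVec m) +
      (-1) ^ k * wedgeEval h2 (a' i p.1)
        (χ p.1 • p.2.2 + alt ((fderiv ℝ χ p.1).smulRight p.2.1)) (stdVec m) with hP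
  have hPc : ∀ i, Continuous (P i) := by
    intro i
    have c1 : Continuous fun p : Space m × (Alt (Space m) l × Alt (Space m) (l + 1)) =>
        (fderiv ℝ χ p.1).smulRight p.2.1 :=
      ((ContinuousLinearMap.smulRightL ℝ (Space m) (Alt (Space m) l)).continuous.comp
        ((hχ1.continuous_fderiv (by simp)).comp continuous_fst)).clm_apply
        (continuous_fst.comp continuous_snd)
    have c2 : Continuous fun p : Space m × (Alt (Space m) l × Alt (Space m) (l + 1)) => χ p.1 :=
      hχ.continuous.comp continuous_fst
    exact (continuous_wedgeEval h1
        ((continuous_extDeriv (ha.contDiff i)).comp continuous_fst)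
        (c2.smul (continuous_fst.comp continuous_snd)) _).add
      (continuous_const.mul (continuous_wedgeEval h2 ((ha.contDiff i).continuous.comp continuous_fst)
        ((c2.smul (continuous_snd.comp continuous_snd)).add (alt.continuous.comp c1)) _))
  set ρ : ℕ → Space m → ℝ := fun n => (shrinkingBump m n).normed volume with hρ
  have hρd : ∀ n, ContDiff ℝ (⊤ : ℕ∞) (ρ n) := fun n => (shrinkingBump m n).contDiff_normed
  have hρc : ∀ n, HasCompactSupport (ρ n) := fun n => (shrinkingBump m n).hasCompactSupport_normed
  set f : ℕ → Space m → Alt (Space m) l × Alt (Space m) (l + 1) := fun n x =>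
    (𝓣.mollify (ρ n) b' x, 𝓣.mollify (ρ n) (fun i => extDeriv (b' i)) x) with hf
  obtain ⟨C₁, hC₁⟩ := 𝓣.exists_bound_glue hB
  obtain ⟨C₂, hC₂⟩ := 𝓣.exists_bound_glue (B := fun i => extDeriv (b' i)) hdB
  have hlim : ∀ i, Tendsto (fun n => ∫ x in 𝓣.cell i, P i (x, f n x)) atTop
      (𝓝 (∫ x in 𝓣.cell i, P i (x, (b' i x, extDeriv (b' i) x)))) := by
    intro i
    refine tendsto_setIntegral_of_bounded (𝓣.isCompact_cell i) (hPc i)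
      (C := max (3 * C₁) (3 * C₂)) (fun n => ?_) (fun n x => ?_) ?_
    · exact (contDiff_mollify (n := ⊤) (hρd n) (hρc n) hB).continuous.prodMk
        (contDiff_mollify (n := ⊤) (hρd n) (hρc n) hdB).continuous
    · exact max_le_max (norm_mollify_le hB _ hC₁ x) (norm_mollify_le hdB _ hC₂ x)
    · filter_upwards [𝓣.interior_ae_eq_cell i] with x hx hxc
      have hxi : x ∈ interior (𝓣.cell i) := (iff_of_eq hx).2 hxc
      exact (tendsto_mollify hB (tendsto_shrinkingBump m) hxi).prodMk_nhds
        (tendsto_mollify hdB (tendsto_shrinkingBump m) hxi)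
  have hsum := tendsto_finsetSum Finset.univ fun i (_ : i ∈ Finset.univ) => hlim i
  obtain ⟨δ, hδ, hδM⟩ := hc.isCompact.exists_cthickening_subset_open isOpen_interior hs
  -- Once the bump radius is below δ, kernels centred in the support of χ stay in the interior of
  -- `M`. Then mollification commutes with the derivative of b wherever χ is nonzero, and χ times
  -- the mollified b is a test form for a.
  have hzero : ∀ᶠ n in atTop, ∑ i, ∫ x in 𝓣.cell i, P i (x, f n x) = 0 := by
    filter_upwards [(tendsto_shrinkingBump m).eventually_lt_const hδ] with n hn
    have hψd : ContDiff ℝ (⊤ : ℕ∞) (𝓣.mollify (ρ n) b') :=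
      contDiff_mollify (hρd n) (hρc n) hB
    have hψ1 : ContDiff ℝ 1 (𝓣.mollify (ρ n) b') := hψd.of_le (by exact_mod_cast le_top)
    have hφ1 : ContDiff ℝ 1 fun x => χ x • 𝓣.mollify (ρ n) b' x := hχ1.smul hψ1
    have hW := ha.sum_integral_extDeriv_wedge haH h1
      (φ := fun x => χ x • 𝓣.mollify (ρ n) b' x) (hχ.smul hψd) hc.smul_right
      ((tsupport_smul_subset_left _ _).trans hs)
    have hd : ∀ x, extDeriv (fun x => χ x • 𝓣.mollify (ρ n) b' x) x =
        χ x • extDeriv (𝓣.mollify (ρ n) b') x +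
          alt ((fderiv ℝ χ x).smulRight (𝓣.mollify (ρ n) b' x)) := fun x =>
      extDeriv_smul_form (hχ1.differentiable (by simp) x) (hψ1.differentiable (by simp) x)
    have hPeq : ∀ i x, P i (x, f n x) =
        wedgeEval h1 (extDeriv (a' i) x) (χ x • 𝓣.mollify (ρ n) b' x) (stdVec m) +
          (-1) ^ k * wedgeEval h2 (a' i x)
            (extDeriv (fun x => χ x • 𝓣.mollify (ρ n) b' x) x) (stdVec m) := by
      intro i x
      rw [hd]
      simp only [hP, hf, wedgeEval_add_right, wedgeEval_smul_right h2]
      by_cases hx : χ x = 0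
      · simp [hx]
      · rw [hb.wedgeEval_extDeriv_mollify hbH h2 (hρd n) (hρc n)]
        refine (tsupport_normed_const_sub_subset _ x).trans (Subset.trans ?_ hδM)
        exact (Metric.closedBall_subset_closedBall hn.le).trans
          (Metric.closedBall_subset_cthickening (subset_tsupport _ hx) δ)
    simp only [hPeq]
    have i1 : ∀ i, IntegrableOn (fun x => wedgeEval h1 (extDeriv (a' i) x)
        (χ x • 𝓣.mollify (ρ n) b' x) (stdVec m)) (𝓣.cell i) := fun i =>
      (continuous_wedgeEval h1 (continuous_extDeriv (ha.contDiff i)) hφ1.continuous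
        _).continuousOn.integrableOn_compact (𝓣.isCompact_cell i)
    have i2 : ∀ i, IntegrableOn (fun x => wedgeEval h2 (a' i x)
        (extDeriv (fun x => χ x • 𝓣.mollify (ρ n) b' x) x) (stdVec m)) (𝓣.cell i) := fun i =>
      (continuous_wedgeEval h2 (ha.contDiff i).continuous (continuous_extDeriv hφ1)
        _).continuousOn.integrableOn_compact (𝓣.isCompact_cell i)
    rw [Finset.sum_congr rfl fun i _ => (integral_add (i1 i) ((i2 i).const_mul _)),
      Finset.sum_add_distrib, hW]
    simp only [integral_const_mul, ← Finset.mul_sum]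
    rw [pow_succ]
    ring
  have hfin := tendsto_nhds_unique (hsum.congr' hzero) tendsto_const_nhds
  rw [← hfin]
  refine Finset.sum_congr rfl fun i _ => integral_congr_ae (.of_forall fun x => ?_)
  have hχb : ContDiff ℝ 1 fun y => χ y • b' i y := hχ1.smul (hb.contDiff i)
  simp only [hP]
  rw [extDeriv_wedge h ((ha.contDiff i).differentiable (by simp) x)
    (hχb.differentiable (by simp) x),
    extDeriv_smul_form (hχ1.differentiable (by simp) x)
      ((hb.contDiff i).differentiable (by simp) x)]
  rfl

/-- Cellwise Stokes for a' ∧ χ b'; on the boundary χ becomes a scalar weight. -/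
lemma IsExtension.sum_bdIntegral_cutoff {a a' : BrokenForm m ι k} {b b' : BrokenForm m ι l}
    (ha : 𝓣.IsExtension a a') (hb : 𝓣.IsExtension b b')
    (haH : MemHForm (interior M) (𝓣.glue a)) (hbH : MemHForm (interior M) (𝓣.glue b))
    (h : k + l = m) {χ : Space m → ℝ} (hχ : ContDiff ℝ (⊤ : ℕ∞) χ) (hc : HasCompactSupport χ)
    (hs : tsupport χ ⊆ interior M) :
    ∑ i, (𝓣.atlas i).bdIntegral χ (fun x => wedge h (a' i x) (b' i x)) = 0 := by
  rw [← ha.sum_integral_extDeriv_cutoff hb haH hbH h hχ hc hs]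
  refine Finset.sum_congr rfl fun i _ => ?_
  have hχb : ContDiff ℝ 1 fun y => χ y • b' i y :=
    (hχ.of_le (by exact_mod_cast le_top)).smul (hb.contDiff i)
  rw [(𝓣.atlas i).integral_extDeriv (𝓣.isCompact_cell i)
    (contDiff_wedge h (ha.contDiff i) hχb)]
  refine Finset.sum_congr rfl fun j _ => ?_
  congr 1
  refine integral_congr_ae (.of_forall fun y => ?_)
  simp only [map_smul, ContinuousAlternatingMap.smul_apply, smul_eq_mul, Pi.one_apply]
  ring

end Mesh

/-! ### Boundary integrals -/

section Boundary

variable {T : Set (Space m)}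

lemma LipschitzChart.exists_lipschitzWith_param (c : LipschitzChart T) :
    ∃ L, LipschitzWith L c.param := by
  obtain ⟨K, hK⟩ := c.lipschitz
  have h1 := c.coord.lipschitz
  have h2 : LipschitzWith (max K 1) fun y : Fin m → ℝ => (c.height y, y) :=
    hK.prodMk LipschitzWith.id
  have h3 := h1.comp h2
  exact ⟨_, h3⟩

lemma LipschitzChart.hasCompactSupport_comp_param (c : LipschitzChart T) {E : Type*} [Zero E]
    {f : Space m → E} (hf : HasCompactSupport f) : HasCompactSupport fun y => f (c.param y) := by
  refine HasCompactSupport.intro (hf.isCompact.image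
    (continuous_snd.comp c.coord.symm.continuous)) fun y hy => ?_
  by_contra hne
  refine hy ⟨c.param y, subset_tsupport _ hne, ?_⟩
  simp [c.param_eq_coord]

lemma continuous_alt_eval (m k : ℕ) :
    Continuous fun p : Alt (Space m) k × (Fin k → Space m) => p.1 p.2 := by
  fun_prop

/-- The integrand of a boundary integral in a chart. -/
def LipschitzAtlas.bdIntegrand (A : LipschitzAtlas T) (j : Fin A.N) (ω : FormField m m)
    (y : Fin m → ℝ) : ℝ :=
  A.cutoff j ((A.chart j).param y) *
    ω ((A.chart j).param y) (fun e => fderiv ℝ (A.chart j).param y (Pi.single e 1))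

/-- The Lipschitz constant bounds the tangent vectors and the cutoff has compact support, which
gives a continuous compactly supported majorant. -/
lemma LipschitzAtlas.integrable_bdIntegrand (A : LipschitzAtlas T) (j : Fin A.N)
    {ω : FormField m m} (hω : Continuous ω) : Integrable (A.bdIntegrand j ω) := by
  set c := A.chart j with hc
  obtain ⟨L, hL⟩ := c.exists_lipschitzWith_param
  have hcont : Continuous fun y => A.cutoff j (c.param y) :=
    (A.smooth j).continuous.comp c.param_continuous
  have hsupp : HasCompactSupport fun y => A.cutoff j (c.param y) :=
    c.hasCompactSupport_comp_param (A.compact_supp j)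
  have hg : Integrable fun y =>
      |A.cutoff j (c.param y)| * (‖ω (c.param y)‖ * ∏ _e : Fin m, (L : ℝ)) := by
    refine Continuous.integrable_of_hasCompactSupport ?_ ?_
    · exact hcont.abs.mul (((hω.comp c.param_continuous).norm).mul continuous_const)
    · exact (hsupp.comp_left (g := fun t : ℝ => |t|) abs_zero).mul_right
  refine hg.mono' ?_ (.of_forall fun y => ?_)
  · refine hcont.aestronglyMeasurable.mul ?_
    have hm : Measurable fun y => fun e : Fin m => fderiv ℝ c.param y (Pi.single e 1) :=
      measurable_pi_lambda _ fun e => measurable_fderiv_apply_const ℝ c.param _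
    exact (continuous_alt_eval m m).comp_aestronglyMeasurable
      ((hω.comp c.param_continuous).aestronglyMeasurable.prodMk hm.aestronglyMeasurable)
  · rw [bdIntegrand, norm_mul, Real.norm_eq_abs]
    refine mul_le_mul_of_nonneg_left ?_ (abs_nonneg _)
    refine (ContinuousAlternatingMap.le_opNorm _ _).trans
      (mul_le_mul_of_nonneg_left ?_ (norm_nonneg _))
    refine Finset.prod_le_prod (fun _ _ => norm_nonneg _) fun e _ => ?_
    refine ((fderiv ℝ c.param y).le_of_opNorm_le (norm_fderiv_le_of_lipschitz ℝ hL) _).trans ?_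
    rw [Pi.norm_single, norm_one, mul_one]

lemma LipschitzAtlas.bdIntegral_eq (A : LipschitzAtlas T) (f : Space m → ℝ) (ω : FormField m m) :
    A.bdIntegral f ω = ∑ j, (A.chart j).orient *
      ∫ y, f ((A.chart j).param y) * A.bdIntegrand j ω y := rfl

lemma LipschitzAtlas.integrable_mul_bdIntegrand (A : LipschitzAtlas T) (j : Fin A.N)
    {ω : FormField m m} (hω : Continuous ω) {f : Space m → ℝ} (hf : Measurable f)
    (hf1 : ∀ x, |f x| ≤ 1) :
    Integrable fun y => f ((A.chart j).param y) * A.bdIntegrand j ω y :=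
  (A.integrable_bdIntegrand j hω).bdd_mul (c := 1)
    (hf.comp (A.chart j).param_continuous.measurable).aestronglyMeasurable
    (.of_forall fun _ => hf1 _)

/-- Dominated convergence. Convergence is demanded at every point, since cell boundaries are null in
the ambient space and an almost everywhere statement would not see them. -/
lemma LipschitzAtlas.tendsto_bdIntegral (A : LipschitzAtlas T) {ω : FormField m m}
    (hω : Continuous ω) {χ : ℕ → Space m → ℝ} {f : Space m → ℝ} (hχ : ∀ n, Continuous (χ n))
    (hχ1 : ∀ n x, |χ n x| ≤ 1) (hlim : ∀ x, Tendsto (fun n => χ n x) atTop (𝓝 (f x))) :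
    Tendsto (fun n => A.bdIntegral (χ n) ω) atTop (𝓝 (A.bdIntegral f ω)) := by
  refine tendsto_finsetSum _ fun j _ => Tendsto.const_mul _ ?_
  refine tendsto_integral_of_dominated_convergence (fun y => ‖A.bdIntegrand j ω y‖)
    (fun n => (A.integrable_mul_bdIntegrand j hω (hχ n).measurable (hχ1 n)).aestronglyMeasurable)
    (A.integrable_bdIntegrand j hω).norm (fun n => .of_forall fun y => ?_)
    (.of_forall fun y => (hlim _).mul_const _)
  rw [norm_mul]
  exact mul_le_of_le_one_left (norm_nonneg _) (hχ1 n _)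

/-- An open subset of a compact set is exhausted by smooth cutoff functions. -/
lemma exists_seq_cutoff {U K : Set (Space m)} (hU : IsOpen U) (hK : IsCompact K) (hUK : U ⊆ K) :
    ∃ χ : ℕ → Space m → ℝ, (∀ n, ContDiff ℝ (⊤ : ℕ∞) (χ n)) ∧ (∀ n, HasCompactSupport (χ n)) ∧
      (∀ n, tsupport (χ n) ⊆ U) ∧ (∀ n x, |χ n x| ≤ 1) ∧
      ∀ x, Tendsto (fun n => χ n x) atTop (𝓝 (U.indicator 1 x)) := by
  -- An increasing exhaustion by closed sets, compact inside `K`; the n-th cutoff will equal 1 on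
  -- the n-th set.
  obtain ⟨F, hFc, hFU, hFun, hFm⟩ := hU.exists_iUnion_isClosed
  have key : ∀ n, ∃ χ : Space m → ℝ, ContDiff ℝ (⊤ : ℕ∞) χ ∧ HasCompactSupport χ ∧
      tsupport χ ⊆ U ∧ (∀ x, |χ x| ≤ 1) ∧ ∀ x ∈ F n, χ x = 1 := by
    intro n
    have hcomp : IsCompact (F n) := hK.of_isClosed_subset (hFc n) ((hFU n).trans hUK)
    obtain ⟨t, ht, hFt, htU⟩ := exists_compact_between hcomp hU (hFU n)
    obtain ⟨χ, h1, h0, h01⟩ := exists_contMDiffMap_one_nhds_of_subset_interior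
      (n := ⊤) 𝓘(ℝ, Space m) (hFc n) hFt
    have hts : tsupport χ ⊆ t := closure_minimal
      (fun x hx => by_contra fun hxt => hx (h0 x hxt)) ht.isClosed
    refine ⟨χ, contMDiff_iff_contDiff.1 χ.contMDiff,
      ht.of_isClosed_subset (isClosed_tsupport _) hts, hts.trans htU, fun x => ?_, fun x hx => ?_⟩
    · rw [abs_of_nonneg (h01 x).1]
      exact (h01 x).2
    · exact (eventually_nhdsSet_iff_forall.1 h1 x hx).self_of_nhds
  choose χ h1 h2 h3 h4 h5 using key
  refine ⟨χ, h1, h2, h3, h4, fun x => ?_⟩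
  by_cases hx : x ∈ U
  · obtain ⟨n, hn⟩ := mem_iUnion.1 (hFun ▸ hx)
    rw [indicator_of_mem hx]
    refine tendsto_const_nhds.congr' ?_
    filter_upwards [eventually_ge_atTop n] with k hk
    exact (h5 k x (hFm hk hn)).symm
  · rw [indicator_of_notMem hx]
    refine tendsto_const_nhds.congr fun n => ?_
    exact (image_eq_zero_of_notMem_tsupport fun hm => hx (h3 n hm)).symm

end Boundary

/-- The boundary integrals of two conforming forms over the inner parts of the cell boundaries
cancel. -/
theorem Mesh.IsExtension.sum_bdIntegral_interior {𝓣 : Mesh M ι} {a a' : BrokenForm m ι k}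
    {b b' : BrokenForm m ι l} (ha : 𝓣.IsExtension a a') (hb : 𝓣.IsExtension b b')
    (haH : MemHForm (interior M) (𝓣.glue a)) (hbH : MemHForm (interior M) (𝓣.glue b))
    (h : k + l = m) :
    ∑ i, (𝓣.atlas i).bdIntegral ((interior M).indicator 1)
      (fun x => wedge h (a' i x) (b' i x)) = 0 := by
  obtain ⟨χ, h1, h2, h3, h4, h5⟩ := exists_seq_cutoff isOpen_interior 𝓣.isCompact interior_subset
  have hlim := tendsto_finsetSum Finset.univ fun i (_ : i ∈ Finset.univ) =>
    (𝓣.atlas i).tendsto_bdIntegral (contDiff_wedge h (ha.contDiff i) (hb.contDiff i)).continuous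
      (fun n => (h1 n).continuous) h4 h5
  refine tendsto_nhds_unique hlim ?_
  simp only [ha.sum_bdIntegral_cutoff hb haH hbH h (h1 _) (h2 _) (h3 _)]
  exact tendsto_const_nhds

end

end PortHam

open MeasureTheory Set Filter Topology

namespace PortHam

noncomputable section

/-! ### Definiteness of the inner product of covectors -/

variable {m k : ℕ}

lemma map_linear_combination {n k : ℕ} (a : Alt (Space m) k) (C : Matrix (Fin n) (Fin n) ℝ)
    (w : Fin n → Space m) (K : Fin k → Fin n) :
    a (fun l => ∑ i, C (K l) i • w i) =
      ∑ I : Fin k → Fin n, (∏ l, C (K l) (I l)) * a (fun l => w (I l)) := by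
  have h1 := a.toMultilinearMap.map_sum (fun l i => C (K l) i • w i)
  refine h1.trans (Finset.sum_congr rfl fun I _ => ?_)
  exact a.toMultilinearMap.map_smul_univ (fun l => C (K l) (I l)) fun l => w (I l)

/-- Factoring the inverse metric splits the double sum: the inner product is the Euclidean product
of the components along the rows of `B`, so definiteness can be read off a sum of squares. -/
lemma covInner_eq_sum {G B : Matrix (Fin (m + 1)) (Fin (m + 1)) ℝ} (hB : G⁻¹ = star B * B)
    (a b : Alt (Space m) k) :
    covInner G a b = (k.factorial : ℝ)⁻¹ * ∑ K : Fin k → Fin (m + 1),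
      a (fun l => ∑ i, B (K l) i • stdVec m i) * b (fun l => ∑ i, B (K l) i • stdVec m i) := by
  have hG : ∀ i j, G⁻¹ i j = ∑ K, B K i * B K j := by
    intro i j
    rw [hB, Matrix.star_eq_conjTranspose, Matrix.mul_apply]
    simp
  rw [covInner]
  congr 1
  simp only [map_linear_combination, hG, Finset.prod_univ_sum, Fintype.piFinset_univ,
    Finset.prod_mul_distrib, Finset.sum_mul, Finset.mul_sum]
  have hc : ∀ I : Fin k → Fin (m + 1), ∑ J : Fin k → Fin (m + 1), ∑ K : Fin k → Fin (m + 1),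
      (∏ l, B (K l) (I l)) * (∏ l, B (K l) (J l)) * a (fun l => stdVec m (I l)) *
        b (fun l => stdVec m (J l)) = ∑ K : Fin k → Fin (m + 1), ∑ J : Fin k → Fin (m + 1),
      (∏ l, B (K l) (I l)) * (∏ l, B (K l) (J l)) * a (fun l => stdVec m (I l)) *
        b (fun l => stdVec m (J l)) := fun I => Finset.sum_comm
  simp only [hc]
  rw [Finset.sum_comm]
  refine Finset.sum_congr rfl fun K _ => ?_
  rw [Finset.sum_comm]
  refine Finset.sum_congr rfl fun I _ => Finset.sum_congr rfl fun J _ => ?_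
  ring

open scoped MatrixOrder Matrix.Norms.L2Operator in
lemma exists_isUnit_inv_eq_star_mul_self {n : Type*} [Fintype n] [DecidableEq n]
    {G : Matrix n n ℝ} (hG : G.PosDef) : ∃ B, IsUnit B ∧ G⁻¹ = star B * B :=
  CStarAlgebra.isStrictlyPositive_iff_eq_star_mul_self.mp hG.inv.isStrictlyPositive

lemma covInner_self_nonneg {G : Matrix (Fin (m + 1)) (Fin (m + 1)) ℝ} (hG : G.PosDef)
    (a : Alt (Space m) k) : 0 ≤ covInner G a a := by
  obtain ⟨B, -, hB⟩ := exists_isUnit_inv_eq_star_mul_self hG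
  rw [covInner_eq_sum hB]
  exact mul_nonneg (by positivity) (Finset.sum_nonneg fun K _ => mul_self_nonneg _)

/-- All squares vanish, so `a` vanishes on tuples of rows of `B`; invertibility of `B` recovers the
standard basis. -/
lemma eq_zero_of_covInner_self {G : Matrix (Fin (m + 1)) (Fin (m + 1)) ℝ} (hG : G.PosDef)
    {a : Alt (Space m) k} (ha : covInner G a a = 0) : a = 0 := by
  obtain ⟨B, hBu, hB⟩ := exists_isUnit_inv_eq_star_mul_self hG
  rw [covInner_eq_sum hB, mul_eq_zero] at ha
  have h0 := ha.resolve_left (inv_ne_zero (by positivity))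
  rw [Finset.sum_eq_zero_iff_of_nonneg fun K _ => mul_self_nonneg _] at h0
  have hu : ∀ K : Fin k → Fin (m + 1), a (fun l => ∑ i, B (K l) i • stdVec m i) = 0 :=
    fun K => mul_self_eq_zero.1 (h0 K (Finset.mem_univ _))
  have hinv : B⁻¹ * B = 1 := Matrix.nonsing_inv_mul B ((Matrix.isUnit_iff_isUnit_det B).1 hBu)
  have hstd : ∀ j, stdVec m j = ∑ κ, B⁻¹ j κ • ∑ i, B κ i • stdVec m i := by
    intro j
    simp only [Finset.smul_sum, smul_smul]
    rw [Finset.sum_comm]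
    simp only [← Finset.sum_smul, ← Matrix.mul_apply, hinv, Matrix.one_apply, ite_smul, one_smul,
      zero_smul, Finset.sum_ite_eq, Finset.mem_univ, if_true]
  have hz : ∀ I : Fin k → Fin (m + 1), a (fun l => stdVec m (I l)) = 0 := by
    intro I
    have hI : (fun l => stdVec m (I l)) =
        fun l => ∑ κ, B⁻¹ (I l) κ • ∑ i, B κ i • stdVec m i := funext fun l => hstd _
    rw [hI, map_linear_combination a B⁻¹ (fun κ => ∑ i, B κ i • stdVec m i) I]
    exact Finset.sum_eq_zero fun K _ => by rw [hu K, mul_zero]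
  have hml : a.toMultilinearMap = 0 := by
    refine Module.Basis.ext_multilinear (fun _ => stdBasis m) fun I => ?_
    simp only [coe_stdBasis]
    exact hz I
  ext v
  exact congrArg (fun F => F v) hml

lemma covInner_sub_right (G : Matrix (Fin (m + 1)) (Fin (m + 1)) ℝ) (a b c : Alt (Space m) k) :
    covInner G a (b - c) = covInner G a b - covInner G a c := by
  simp only [covInner, ContinuousAlternatingMap.sub_apply, mul_sub, Finset.sum_sub_distrib]

lemma covInner_smul_right (G : Matrix (Fin (m + 1)) (Fin (m + 1)) ℝ) (c : ℝ)
    (a b : Alt (Space m) k) : covInner G a (c • b) = c * covInner G a b := by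
  simp only [covInner, ContinuousAlternatingMap.smul_apply, smul_eq_mul, Finset.mul_sum]
  refine Finset.sum_congr rfl fun I _ => Finset.sum_congr rfl fun J _ => ?_
  ring

lemma continuousOn_covInner {S : Set (Space m)}
    {g : Space m → Matrix (Fin (m + 1)) (Fin (m + 1)) ℝ} (hg : ContinuousOn g S)
    (hdet : ∀ x ∈ S, (g x).det ≠ 0) {a b : FormField m k} (ha : ContinuousOn a S)
    (hb : ContinuousOn b S) : ContinuousOn (fun x => covInner (g x) (a x) (b x)) S := by
  have hinv : ∀ i j, ContinuousOn (fun x => (g x)⁻¹ i j) S := by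
    intro i j
    simp only [Matrix.inv_def, Matrix.smul_apply, Ring.inverse_eq_inv', smul_eq_mul]
    refine ContinuousOn.mul (ContinuousOn.inv₀ ?_ hdet) ?_
    · exact (Continuous.matrix_det continuous_id).comp_continuousOn hg
    · exact ((Continuous.matrix_adjugate continuous_id).matrix_elem i j).comp_continuousOn hg
  have hev : ∀ {c : FormField m k}, ContinuousOn c S → ∀ v, ContinuousOn (fun x => c x v) S :=
    fun hc v => (ContinuousAlternatingMap.apply ℝ (Space m) ℝ v).continuous.comp_continuousOn hc
  unfold covInner
  refine continuousOn_const.mul (continuousOn_finsetSum _ fun I _ =>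
    continuousOn_finsetSum _ fun J _ => ?_)
  exact ((continuousOn_finsetProd _ fun l _ => hinv _ _).mul (hev ha _)).mul (hev hb _)

/-! ### Identification of broken forms by their moments -/

variable {M : Set (Space m)} {ι : Type} [Fintype ι] {𝓣 : Mesh M ι}
  {g : Space m → Matrix (Fin (m + 1)) (Fin (m + 1)) ℝ}

lemma Mesh.cell_subset (𝓣 : Mesh M ι) (i : ι) : 𝓣.cell i ⊆ M :=
  (subset_iUnion 𝓣.cell i).trans 𝓣.iUnion_cell.subset

lemma continuousOn_of_mem_cellForms {T : Set (Space m)} {a : FormField m k}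
    (ha : a ∈ cellForms T k) : ContinuousOn a T := by
  obtain ⟨-, a', ha', h⟩ := ha
  exact ha'.continuous.continuousOn.congr h

lemma Mesh.continuousOn_inner (𝓣 : Mesh M ι) (hg : IsRiemannianMetric M g) {i : ι}
    {a b : FormField m k} (ha : a ∈ cellForms (𝓣.cell i) k) (hb : b ∈ cellForms (𝓣.cell i) k) :
    ContinuousOn (fun x => covInner (g x) (a x) (b x) * √(g x).det) (𝓣.cell i) := by
  have hgc := hg.cont.mono (𝓣.cell_subset i)
  refine (continuousOn_covInner hgc (fun x hx => (hg.posDef x (𝓣.cell_subset i hx)).det_pos.ne')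
    (continuousOn_of_mem_cellForms ha) (continuousOn_of_mem_cellForms hb)).mul ?_
  exact ((Continuous.matrix_det continuous_id).comp_continuousOn hgc).sqrt

lemma Mesh.inner_sub_smul (𝓣 : Mesh M ι) (hg : IsRiemannianMetric M g) (c : ℝ)
    {v a b : BrokenForm m ι k} (hv : ∀ i, v i ∈ cellForms (𝓣.cell i) k)
    (ha : ∀ i, a i ∈ cellForms (𝓣.cell i) k) (hb : ∀ i, b i ∈ cellForms (𝓣.cell i) k) :
    𝓣.inner g v (a - c • b) = 𝓣.inner g v a - c * 𝓣.inner g v b := by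
  simp only [Mesh.inner, Finset.mul_sum, ← Finset.sum_sub_distrib, ← integral_const_mul]
  refine Finset.sum_congr rfl fun i _ => ?_
  rw [← integral_sub]
  · congr 1
    ext x
    simp only [Pi.sub_apply, Pi.smul_apply, covInner_sub_right, covInner_smul_right]
    ring
  · exact (𝓣.continuousOn_inner hg (hv i) (ha i)).integrableOn_compact (𝓣.isCompact_cell i)
  · exact ((𝓣.continuousOn_inner hg (hv i) (hb i)).integrableOn_compact
      (𝓣.isCompact_cell i)).const_mul c

lemma Mesh.ae_eq_zero_of_inner_self (𝓣 : Mesh M ι) (hg : IsRiemannianMetric M g)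
    {v : BrokenForm m ι k} (hv : ∀ i, v i ∈ cellForms (𝓣.cell i) k) (h0 : 𝓣.inner g v v = 0)
    (i : ι) : ∀ᵐ x, x ∈ 𝓣.cell i → v i x = 0 := by
  have hmeas : ∀ i, MeasurableSet (𝓣.cell i) := fun i => (𝓣.isCompact_cell i).measurableSet
  have hpos : ∀ i, ∀ x ∈ 𝓣.cell i, 0 ≤ covInner (g x) (v i x) (v i x) * √(g x).det :=
    fun i x hx => mul_nonneg
      (covInner_self_nonneg (hg.posDef x (𝓣.cell_subset i hx)) _) (Real.sqrt_nonneg _)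
  have h1 := (Finset.sum_eq_zero_iff_of_nonneg fun i _ =>
    setIntegral_nonneg (hmeas i) (hpos i)).1 h0 i (Finset.mem_univ _)
  rw [setIntegral_eq_zero_iff_of_nonneg_ae ((ae_restrict_iff' (hmeas i)).2 (.of_forall (hpos i)))
    ((𝓣.continuousOn_inner hg (hv i) (hv i)).integrableOn_compact (𝓣.isCompact_cell i))] at h1
  filter_upwards [(ae_restrict_iff' (hmeas i)).1 h1] with x hx hxT
  have hG := hg.posDef x (𝓣.cell_subset i hxT)
  exact eq_zero_of_covInner_self hG
    ((mul_eq_zero.1 (hx hxT)).resolve_right (Real.sqrt_pos.2 hG.det_pos).ne')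

/-- The residual `a - c • b` lies in the broken space and is its own test form. Thus a variational
equation of the scheme becomes a pointwise one. -/
lemma DiscreteComplex.ae_eq_smul_of_inner (C : DiscreteComplex 𝓣) (hg : IsRiemannianMetric M g)
    {a b : BrokenForm m ι k} (ha : a ∈ C.broken k) (hb : b ∈ C.broken k) {c : ℝ}
    (h : ∀ v ∈ C.broken k, 𝓣.inner g v a = c * 𝓣.inner g v b) (i : ι) :
    ∀ᵐ x, x ∈ 𝓣.cell i → a i x = c • b i x := by
  have hv : a - c • b ∈ C.broken k := fun i => (C.W i k).sub_mem (ha i) ((C.W i k).smul_mem c (hb i))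
  have hW : ∀ {w : BrokenForm m ι k}, w ∈ C.broken k → ∀ i, w i ∈ cellForms (𝓣.cell i) k :=
    fun hw i => C.W_le i k (hw i)
  have h0 : 𝓣.inner g (a - c • b) (a - c • b) = 0 := by
    rw [𝓣.inner_sub_smul hg c (hW hv) (hW ha) (hW hb), h _ hv, sub_self]
  filter_upwards [𝓣.ae_eq_zero_of_inner_self hg (hW hv) h0 i] with x hx hxT
  exact sub_eq_zero.1 (hx hxT)

/-! ### Trajectories in finite dimensional spaces of forms -/

/-- Difference quotients stay in `W`, and a finite-dimensional subspace is closed under pointwise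
limits. -/
lemma derivWithin_mem_of_forall_mem {X E : Type*} [NormedAddCommGroup E] [NormedSpace ℝ E]
    (W : Submodule ℝ (X → E)) [FiniteDimensional ℝ W] {Tend t : ℝ} (ht : t ∈ Ioc 0 Tend)
    {f : ℝ → X → E} (hf : ∀ τ ∈ Ioc 0 Tend, f τ ∈ W)
    (hd : ∀ x, DifferentiableOn ℝ (fun τ => f τ x) (Ioc 0 Tend)) :
    (fun x => derivWithin (fun τ => f τ x) (Ioc 0 Tend) t) ∈ W := by
  have hclosed : IsClosed (W : Set (X → E)) := W.closed_of_finiteDimensional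
  have hlim : Tendsto (fun τ => slope f t τ) (𝓝[Ioc 0 Tend \ {t}] t)
      (𝓝 fun x => derivWithin (fun τ => f τ x) (Ioc 0 Tend) t) := by
    refine tendsto_pi_nhds.2 fun x => ?_
    exact hasDerivWithinAt_iff_tendsto_slope.1 (hd x t ht).hasDerivWithinAt
  -- Approach from the left, which also covers the end time t = `Tend`.
  have hsub : Ioo 0 t ⊆ Ioc 0 Tend \ {t} := fun τ hτ =>
    ⟨⟨hτ.1, hτ.2.le.trans ht.2⟩, hτ.2.ne⟩
  have : (𝓝[Ioo 0 t] t).NeBot := right_nhdsWithin_Ioo_neBot ht.1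
  have hne : (𝓝[Ioc 0 Tend \ {t}] t).NeBot := this.mono (nhdsWithin_mono t hsub)
  refine hclosed.mem_of_tendsto hlim ?_
  filter_upwards [self_mem_nhdsWithin] with τ hτ
  rw [slope_def_module]
  exact W.smul_mem _ (W.sub_mem (hf τ hτ.1) (hf t ht))

lemma DiscreteComplex.dt_mem_broken (C : DiscreteComplex 𝓣) {Tend t : ℝ} (ht : t ∈ Ioc 0 Tend)
    {a : ℝ → BrokenForm m ι k} (ha : ∀ τ ∈ Ioc 0 Tend, a τ ∈ C.broken k)
    (hd : TimeDiff (Ioc 0 Tend) a) : dt (Ioc 0 Tend) a t ∈ C.broken k := by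
  intro i
  have := C.W_finite i k
  exact derivWithin_mem_of_forall_mem (C.W i k) ht (fun τ hτ => ha τ hτ i) (hd i)

/-! ### Elementwise exterior derivatives -/

lemma cellD_eq_extDeriv {T : Set (Space m)} {ω ω' : FormField m k} (h : EqOn ω ω' T)
    {x : Space m} (hx : x ∈ interior T) : cellD T ω x = extDeriv ω' x := by
  have hT : T ∈ 𝓝 x := mem_interior_iff_mem_nhds.1 hx
  have hω : ω =ᶠ[𝓝 x] ω' := by
    filter_upwards [hT] with y hy
    exact h hy
  rw [cellD, indicator_of_mem (interior_subset hx), extDerivWithin, extDeriv,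
    fderivWithin_of_mem_nhds hT, hω.fderiv_eq]

lemma Mesh.IsExtension.ae_d_eq {a a' : BrokenForm m ι k} (ha : 𝓣.IsExtension a a') (i : ι) :
    ∀ᵐ x, x ∈ 𝓣.cell i → 𝓣.d a i x = extDeriv (a' i) x := by
  filter_upwards [(𝓣.interior_ae_eq_cell i).mem_iff] with x hx hxT
  exact cellD_eq_extDeriv (ha.eqOn i) (hx.2 hxT)

lemma DiscreteComplex.exists_isExtension (C : DiscreteComplex 𝓣) {a : BrokenForm m ι k}
    (ha : a ∈ C.V k) : ∃ a', 𝓣.IsExtension a a' := by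
  choose a' h1 h2 using fun i => (C.W_le i k (C.V_restrict k a ha i)).2
  exact ⟨a', h1, h2⟩

end

end PortHam

open MeasureTheory Set Filter Topology

namespace PortHam

noncomputable section

/-! ### The power balance -/

variable {m k l : ℕ} {T M : Set (Space m)} {ι : Type} [Fintype ι]

/-- Projection to the graph coordinates is a Lipschitz left inverse of the parametrization, so it
sends Hausdorff null sets to Lebesgue null sets. -/
lemma LipschitzChart.ae_param_notMem (c : LipschitzChart T) {S : Set (Space m)}
    (hS : Measure.hausdorffMeasure (m : ℝ) S = 0) : ∀ᵐ y, c.param y ∉ S := by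
  have hlip := LipschitzWith.prod_snd.comp c.coord.symm.lipschitz
  have h1 := hlip.hausdorffMeasure_image_le (Nat.cast_nonneg m) S
  rw [hS, mul_zero, nonpos_iff_eq_zero] at h1
  have h2 : volume ((Prod.snd ∘ c.coord.symm) '' S) = 0 := by
    have h3 := hausdorffMeasure_pi_real (ι := Fin m)
    rw [Fintype.card_fin] at h3
    rw [← h3]
    exact h1
  refine measure_mono_null (fun y hy => ?_) h2
  refine ⟨c.param y, not_not.1 hy, ?_⟩
  simp [c.param_eq_coord]

lemma IsBoundaryPartition.measurableSet₁ {Γ₁ Γ₂ : Set (Space m)}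
    (h : IsBoundaryPartition M Γ₁ Γ₂) : MeasurableSet Γ₁ := by
  obtain ⟨O, hO, rfl⟩ := h.open₁
  exact hO.measurableSet.inter isClosed_frontier.measurableSet

lemma IsBoundaryPartition.measurableSet₂ {Γ₁ Γ₂ : Set (Space m)}
    (h : IsBoundaryPartition M Γ₁ Γ₂) : MeasurableSet Γ₂ := by
  obtain ⟨O, hO, rfl⟩ := h.open₂
  exact hO.measurableSet.inter isClosed_frontier.measurableSet

lemma abs_indicator_one_le {X : Type*} (S : Set X) (x : X) :
    |S.indicator (1 : X → ℝ) x| ≤ 1 := by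
  by_cases hx : x ∈ S <;> simp [hx]

/-- The boundary integral over a cell of a mesh splits into the contributions of the interior of
the domain and of the two parts of its boundary. -/
lemma Mesh.bdIntegral_eq_add (𝓣 : Mesh M ι) {Γ₁ Γ₂ : Set (Space m)}
    (hΓ : IsBoundaryPartition M Γ₁ Γ₂) (i : ι) {ω : FormField m m} (hω : Continuous ω) :
    (𝓣.atlas i).bdIntegral 1 ω = (𝓣.atlas i).bdIntegral ((interior M).indicator 1) ω +
      ((𝓣.atlas i).bdIntegral (Γ₁.indicator 1) ω + (𝓣.atlas i).bdIntegral (Γ₂.indicator 1) ω) := by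
  have hΓ₁ : Γ₁ ⊆ frontier M := by
    obtain ⟨O, -, hO⟩ := hΓ.open₁
    exact hO ▸ inter_subset_right
  have hΓ₂ : Γ₂ ⊆ frontier M := by
    obtain ⟨O, -, hO⟩ := hΓ.open₂
    exact hO ▸ inter_subset_right
  simp only [LipschitzAtlas.bdIntegral_eq, ← Finset.sum_add_distrib, ← mul_add]
  refine Finset.sum_congr rfl fun j _ => ?_
  have hI : ∀ S : Set (Space m), MeasurableSet S → Integrable fun y =>
      S.indicator (1 : Space m → ℝ) (((𝓣.atlas i).chart j).param y) *
        (𝓣.atlas i).bdIntegrand j ω y := fun S hS =>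
    (𝓣.atlas i).integrable_mul_bdIntegrand j hω (measurable_one.indicator hS)
      (abs_indicator_one_le S)
  have h1 := hI _ hΓ.measurableSet₁
  have h2 := hI _ hΓ.measurableSet₂
  have h12 : Integrable fun y =>
      Γ₁.indicator (1 : Space m → ℝ) (((𝓣.atlas i).chart j).param y) *
          (𝓣.atlas i).bdIntegrand j ω y +
        Γ₂.indicator (1 : Space m → ℝ) (((𝓣.atlas i).chart j).param y) *
          (𝓣.atlas i).bdIntegrand j ω y := h1.add h2
  rw [← integral_add h1 h2, ← integral_add (hI _ isOpen_interior.measurableSet) h12]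
  congr 1
  refine integral_congr_ae ?_
  filter_upwards [((𝓣.atlas i).chart j).ae_param_notMem hΓ.interface_null] with y hy
  -- Where the cutoff is nonzero, the point lies on the frontier of the cell, hence in `M`, and so
  -- in exactly one of the three pieces.
  by_cases hU : (𝓣.atlas i).cutoff j (((𝓣.atlas i).chart j).param y) = 0
  · simp [LipschitzAtlas.bdIntegrand, hU]
  set x := ((𝓣.atlas i).chart j).param y with hx
  have hxT : x ∈ 𝓣.cell i := (𝓣.isCompact_cell i).isClosed.frontier_subset
    (((𝓣.atlas i).chart j).param_mem_frontier
      ((𝓣.atlas i).supp_subset j (subset_tsupport _ hU)))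
  have hxM : x ∈ M := 𝓣.cell_subset i hxT
  simp only [← add_mul]
  congr 1
  by_cases hint : x ∈ interior M
  · have hf : x ∉ frontier M := fun hf => hf.2 hint
    have hx1 : x ∉ Γ₁ := fun hm => hf (hΓ₁ hm)
    have hx2 : x ∉ Γ₂ := fun hm => hf (hΓ₂ hm)
    simp [hint, hx1, hx2]
  · have hf : x ∈ frontier M := ⟨subset_closure hxM, hint⟩
    by_cases hx1 : x ∈ Γ₁
    · simp [hint, hx1, disjoint_left.1 hΓ.disjoint hx1]
    · have hx2 : x ∈ Γ₂ := by_contra fun hx2 => hy ⟨hf, not_or.2 ⟨hx1, hx2⟩⟩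
      simp [hint, hx1, hx2]

/-- Boundary data matter only almost everywhere on `Γ` and where the cutoff is nonzero, so the
essential conditions allow them to be replaced by traces. The scalar `c` carries the sign (-1)^p. -/
lemma Mesh.IsExtension.bdDual_eq {𝓣 : Mesh M ι} {a a' : BrokenForm m ι k}
    {b b' : BrokenForm m ι l} (ha : 𝓣.IsExtension a a') (hb : 𝓣.IsExtension b b')
    (h : k + l = m) {Γ : Set (Space m)} (hΓ : MeasurableSet Γ) {A : 𝓣.BdForm k}
    {B : 𝓣.BdForm l} {c : ℝ} (hA : 𝓣.EqOnBd Γ (c • 𝓣.tr a) A) (hB : 𝓣.EqOnBd Γ (𝓣.tr b) B) :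
    𝓣.bdDual h Γ A B = c * ∑ i, (𝓣.atlas i).bdIntegral (Γ.indicator 1)
      (fun x => wedge h (a' i x) (b' i x)) := by
  simp only [Mesh.bdDual, LipschitzAtlas.bdIntegral_eq, Finset.mul_sum]
  refine Finset.sum_congr rfl fun i _ => Finset.sum_congr rfl fun j _ => ?_
  have hpre : MeasurableSet (((𝓣.atlas i).chart j).param ⁻¹' Γ) :=
    ((𝓣.atlas i).chart j).param_continuous.measurable hΓ
  rw [mul_left_comm c, ← integral_const_mul c, ← integral_indicator hpre]
  congr 1
  refine integral_congr_ae ?_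
  filter_upwards [hA i j, hB i j] with y hAy hBy
  by_cases hy : ((𝓣.atlas i).chart j).param y ∈ Γ
  swap
  · rw [indicator_of_notMem (by exact hy), indicator_of_notMem hy]
    ring
  rw [indicator_of_mem (by exact hy), indicator_of_mem hy, LipschitzAtlas.bdIntegrand,
    Pi.one_apply, one_mul]
  by_cases h0 : (𝓣.atlas i).cutoff j (((𝓣.atlas i).chart j).param y) = 0
  · simp [h0]
  have hU := (𝓣.atlas i).supp_subset j (subset_tsupport _ h0)
  have hxT : ((𝓣.atlas i).chart j).param y ∈ 𝓣.cell i :=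
    (𝓣.isCompact_cell i).isClosed.frontier_subset (((𝓣.atlas i).chart j).param_mem_frontier hU)
  rw [← hAy ⟨hy, hU⟩, ← hBy ⟨hy, hU⟩]
  -- The wedge of the pullbacks on coordinate vectors is by definition the wedge on the tangent
  -- vectors.
  simp only [Pi.smul_apply, wedgeEval_smul_left, wedge_apply]
  rw [← ha.eqOn i hxT, ← hb.eqOn i hxT, mul_left_comm]
  rfl

/-- Integration by parts for two conforming piecewise smooth forms. -/
lemma Mesh.IsExtension.sum_integral_extDeriv_wedge_eq {𝓣 : Mesh M ι} {a a' : BrokenForm m ι k}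
    {b b' : BrokenForm m ι l} (ha : 𝓣.IsExtension a a') (hb : 𝓣.IsExtension b b')
    (haH : MemHForm (interior M) (𝓣.glue a)) (hbH : MemHForm (interior M) (𝓣.glue b))
    (h : k + l = m) {Γ₁ Γ₂ : Set (Space m)} (hΓ : IsBoundaryPartition M Γ₁ Γ₂) :
    ∑ i, ∫ x in 𝓣.cell i, extDeriv (fun y => wedge h (a' i y) (b' i y)) x (stdVec m) =
      ∑ i, (𝓣.atlas i).bdIntegral (Γ₁.indicator 1) (fun x => wedge h (a' i x) (b' i x)) +
      ∑ i, (𝓣.atlas i).bdIntegral (Γ₂.indicator 1) (fun x => wedge h (a' i x) (b' i x)) := by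
  have hω : ∀ i, ContDiff ℝ 1 fun x => wedge h (a' i x) (b' i x) := fun i =>
    contDiff_wedge h (ha.contDiff i) (hb.contDiff i)
  have hS : ∀ i, ∫ x in 𝓣.cell i, extDeriv (fun y => wedge h (a' i y) (b' i y)) x (stdVec m) =
      _ := fun i => ((𝓣.atlas i).integral_extDeriv (𝓣.isCompact_cell i) (hω i)).trans
        (𝓣.bdIntegral_eq_add hΓ i (hω i).continuous)
  simp only [hS, Finset.sum_add_distrib]
  rw [ha.sum_bdIntegral_interior hb haH hbH h, zero_add]

/-- The volume terms of the power balance. -/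
lemma Mesh.IsExtension.dual_add_dual {𝓣 : Mesh M ι} {a a' : BrokenForm m ι k}
    {b b' : BrokenForm m ι l} (ha : 𝓣.IsExtension a a') (hb : 𝓣.IsExtension b b') (h : k + l = m)
    (h₁ : l + (k + 1) = m + 1) (h₂ : k + (l + 1) = m + 1)
    {A : BrokenForm m ι (k + 1)} {B : BrokenForm m ι (l + 1)}
    (hA : ∀ i, ∀ᵐ x, x ∈ 𝓣.cell i → A i x = (-1 : ℝ) ^ (k + 1) • 𝓣.d a i x)
    (hB : ∀ i, ∀ᵐ x, x ∈ 𝓣.cell i → B i x = (-1 : ℝ) • 𝓣.d b i x) :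
    (-1 : ℝ) ^ ((k + 1) * l) * 𝓣.dual h₁ b A +
        𝓣.dual h₂ a B =
      (-1) ^ (k + 1) * ∑ i, ∫ x in 𝓣.cell i,
        extDeriv (fun y => wedge h (a' i y) (b' i y)) x (stdVec m) := by
  have h₃ : k + 1 + l = m + 1 := (add_comm _ _).trans h₁
  simp only [Mesh.dual, Finset.mul_sum, ← Finset.sum_add_distrib]
  refine Finset.sum_congr rfl fun i _ => ?_
  have hT := (𝓣.isCompact_cell i).measurableSet
  have e1 : ∫ x in 𝓣.cell i, wedgeEval h₁ (b i x) (A i x)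
      (stdVec m) = ∫ x in 𝓣.cell i, (-1) ^ ((k + 1) * l) * ((-1) ^ (k + 1) *
        wedgeEval h₃ (extDeriv (a' i) x) (b' i x) (stdVec m)) := by
    refine setIntegral_congr_ae hT ?_
    filter_upwards [hA i, ha.ae_d_eq i] with x hx hd hxT
    -- The sign of graded commutativity equals the prefactor of the first dual term, so the two
    -- cancel.
    rw [wedgeEval_comm, hx hxT, hd hxT, hb.eqOn i hxT, wedgeEval_smul_left, mul_comm l]
  have e2 : ∫ x in 𝓣.cell i, wedgeEval h₂ (a i x) (B i x)
      (stdVec m) = ∫ x in 𝓣.cell i, (-1) *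
        wedgeEval h₂ (a' i x) (extDeriv (b' i) x) (stdVec m) := by
    refine setIntegral_congr_ae hT ?_
    filter_upwards [hB i, hb.ae_d_eq i] with x hx hd hxT
    rw [hx hxT, hd hxT, ha.eqOn i hxT, wedgeEval_smul_right]
  have hj1 : IntegrableOn (fun x => wedgeEval h₃ (extDeriv (a' i) x)
      (b' i x) (stdVec m)) (𝓣.cell i) :=
    (continuous_wedgeEval _ (continuous_extDeriv (ha.contDiff i)) (hb.contDiff i).continuous
      _).continuousOn.integrableOn_compact (𝓣.isCompact_cell i)
  have hj2 : IntegrableOn (fun x => wedgeEval h₂ (a' i x)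
      (extDeriv (b' i) x) (stdVec m)) (𝓣.cell i) :=
    (continuous_wedgeEval _ (ha.contDiff i).continuous (continuous_extDeriv (hb.contDiff i))
      _).continuousOn.integrableOn_compact (𝓣.isCompact_cell i)
  have hL : ∀ x, extDeriv (fun y => wedge h (a' i y) (b' i y)) x (stdVec m) =
      wedgeEval h₃ (extDeriv (a' i) x) (b' i x) (stdVec m) +
        (-1) ^ k * wedgeEval h₂ (a' i x) (extDeriv (b' i) x)
          (stdVec m) := fun x =>
    extDeriv_wedge h ((ha.contDiff i).differentiable (by simp) x)
      ((hb.contDiff i).differentiable (by simp) x) _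
  simp only [hL]
  -- On the a ∧ db term, (-1)^(k+1) (-1)^k = -1 is the minus sign carried by `B`.
  rw [e1, e2, integral_add hj1 (hj2.const_mul _), integral_const_mul, integral_const_mul,
    integral_const_mul, integral_const_mul, ← mul_assoc, ← pow_add, ← two_mul, pow_mul,
    neg_one_sq, one_pow, one_mul, mul_add, ← mul_assoc ((-1 : ℝ) ^ (k + 1)) ((-1) ^ k),
    ← pow_add, show k + 1 + k = 2 * k + 1 by ring, pow_succ (-1 : ℝ) (2 * k), pow_mul,
    neg_one_sq, one_pow, one_mul]

end

end PortHam

theorem proposition1 {m r s : ℕ} (h : r + s = m) {M : Set (PortHam.Space m)}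
    (_hM : PortHam.IsLipschitzDomain M)
    {g : PortHam.Space m → Matrix (Fin (m + 1)) (Fin (m + 1)) ℝ}
    (_hg : PortHam.IsRiemannianMetric M g)
    {Γ₁ Γ₂ : Set (PortHam.Space m)} (_hΓ : PortHam.IsBoundaryPartition M Γ₁ Γ₂)
    {ι : Type} [Fintype ι] (𝓣 : PortHam.Mesh M ι) (Co Ci : PortHam.DiscreteComplex 𝓣)
    {Tend : ℝ} (u₁ : ℝ → 𝓣.BdForm s) (u₂ : ℝ → 𝓣.BdForm r)
    (αo : ℝ → PortHam.BrokenForm m ι (r + 1)) (βo : ℝ → PortHam.BrokenForm m ι r)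
    (αi : ℝ → PortHam.BrokenForm m ι s) (βi : ℝ → PortHam.BrokenForm m ι (s + 1))
    (_hprimal : PortHam.IsPrimalSolution 𝓣 g h Γ₁ Γ₂ Co Ci (Set.Ioc 0 Tend) u₁ u₂ αo βo)
    (_hdual : PortHam.IsDualSolution 𝓣 g h Γ₁ Γ₂ Co Ci (Set.Ioc 0 Tend) u₁ u₂ αi βi)
    (t : ℝ) (_ht : t ∈ Set.Ioc 0 Tend) :
    (-1 : ℝ) ^ ((r + 1) * s) *
          𝓣.dual (by omega : s + (r + 1) = m + 1) (αi t) (PortHam.dt (Set.Ioc 0 Tend) αo t) +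
        𝓣.dual (by omega : r + (s + 1) = m + 1) (βo t) (PortHam.dt (Set.Ioc 0 Tend) βi t) =
      𝓣.bdDual h Γ₁ (PortHam.output₂ 𝓣 βo t) (u₁ t) +
        𝓣.bdDual h Γ₂ (u₂ t) (PortHam.output₁ 𝓣 αi t) := by
  have hβo := _hprimal.β_mem t _ht
  have hαi := _hdual.α_mem t _ht
  obtain ⟨a', ha⟩ := Co.exists_isExtension hβo
  obtain ⟨b', hb⟩ := Ci.exists_isExtension hαi
  -- The inclusions dV ⊆ V ⊆ W put the exterior derivative into the broken space, as testing with
  -- the residual requires.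
  have hA := Co.ae_eq_smul_of_inner _hg (Co.dt_mem_broken _ht _hprimal.α_mem _hprimal.α_diff)
    (Co.V_restrict _ _ (Co.V_d _ _ hβo)) (_hprimal.eq₁ t _ht)
  have hB := Ci.ae_eq_smul_of_inner _hg (Ci.dt_mem_broken _ht _hdual.β_mem _hdual.β_diff)
    (Ci.V_restrict _ _ (Ci.V_d _ _ hαi)) (c := -1)
    fun v hv => (_hdual.eq₂ t _ht v hv).trans (neg_one_mul _).symm
  -- On Γ₁ the dual essential condition supplies `u₁` while the output is a trace by definition; on
  -- Γ₂ the primal condition supplies `u₂` and the roles are exchanged.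
  rw [ha.dual_add_dual hb h _ _ hA hB, ha.sum_integral_extDeriv_wedge_eq hb
      (Co.V_conforming _ _ hβo) (Ci.V_conforming _ _ hαi) h _hΓ,
    ha.bdDual_eq hb h _hΓ.measurableSet₁ (A := PortHam.output₂ 𝓣 βo t)
      (c := (-1) ^ (r + 1)) (fun _ _ => .of_forall fun _ _ => rfl) (_hdual.essential t _ht),
    ha.bdDual_eq hb h _hΓ.measurableSet₂ (B := PortHam.output₁ 𝓣 αi t)
      (_hprimal.essential t _ht) (fun _ _ => .of_forall fun _ _ => rfl), mul_add]
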